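/- Let $N\ge 4$ be even, and let $0\le M\le N$ be admissible, i.e. $M\equiv N/2 \pmod 2$. On $(\mathbb C^2)^{\otimes N}$ with periodic boundary conditions ($\sigma^\alpha_{N+1}=\sigma^\alpha_1$) put $$X_n=\sigma^x_n\sigma^y_{n+1}-\sigma^y_n\sigma^x_{n+1},\qquad n=1,\dots,N .$$ Chiral basis: for $\kappa=\pm1$ and $\mathbf n=(n_1<\dots<n_M)$ in $\{1,\dots,N\}$, $$|\kappa;\mathbf n\rangle=(-\mathrm i)^{\sum_j n_j}\bigotimes_{l=1}^N\psi\bigl(l-2\,\#\{j:n_j<l\}-\kappa\bigr),\qquad \psi(k)=\tfrac1{\sqrt2}\binom{1}{\mathrm i^k}.$$ For $\xi\in\{0,1\}$ and one-kink amplitudes $A_n(1),\dots,A_n(M)$, $1\le n\le N$, put $$|\Psi_A\rangle=\sum_{n_1<\dots<n_M}\ \sum_{\kappa=\pm1}\frac{1}{\sqrt{2N^M}}\det_{j,l}\bigl(A_{n_j}(l)\bigr)\,\kappa^\xi\,|\kappa;\mathbf n\rangle .$$ Let $\theta_1,\theta_3,\theta_4$ be the Jacobi theta functions with nome $q=e^{\mathrm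 i\pi\tau}$, $\tau\in\mathrm i\mathbb R_{>0}$: $\theta_1(u)=2\sum_{n\ge0}(-1)^nq^{(n+1/2)^2}\sin((2n+1)\pi u)$, $\theta_3(u)=1+2\sum_{n\ge1}q^{n^2}\cos(2n\pi u)$, $\theta_4(u)=1+2\sum_{n\ge1}(-1)^nq^{n^2}\cos(2n\pi u)$. Put $J_x=\theta_3(0)/\theta_4(0)$, $J_y=1/J_x$, $r(u)=\theta_1(u+\tfrac14)/\theta_1(u-\tfrac14)$, and let $\epsilon_n=(-1)^n$. The chiral eigenstates are the following vectors. * **XY chain, Bethe roots.** $|\Psi_M(\mathbf u)\rangle$: amplitudes $A_n(l)=r(u_l)^n\bigl[\theta_3(u_l+\tfrac{\epsilon_n}4)/\theta_3(u_l-\tfrac{\epsilon_n}4)\bigr]^{1/2}$ (principal root), where $u_1,\dots,u_M$ are pairwise distinct solutions of $r(u_j)^N=(-1)^{\xi+1}$ in the union of the rectangles $-\frac12<\mathrm{Re}\,u\le0,\ -\frac{\mathrm{Im}\,\tau}2<\mathrm{Im}\,u\le\frac{\mathrm{Im}\,\tau}2$ and $0<\mathrm{Re}\,u\le\frac12,\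 -\frac{\mathrm{Im}\,\tau}2\le\mathrm{Im}\,u<\frac{\mathrm{Im}\,\tau}2$. Their quasi-momenta are real numbers $p_j$ with $e^{\mathrm ip_j}=r(u_j)$. * **XY chain, quasi-momenta.** $|\widetilde\Psi_M(\mathbf p)\rangle$: amplitudes $A_n(l)=\exp[\mathrm i(np_l-\epsilon_n\varphi(p_l))]$ with $\varphi(p)=\frac12\arctan\bigl(\frac{J_x-J_y}{J_x+J_y}\tan p\bigr)$, and $\varphi(p)=\frac\pi4$ where $\cos p=0$, for pairwise distinct $p_j\in(-\frac\pi2,\frac{3\pi}2]$ with $e^{\mathrm iNp_j}=(-1)^{\xi+1}$. * **XX chain.** $|\mu_M(\mathbf p)\rangle$: amplitudes $A_n(l)=e^{\mathrm inp_l}$, for pairwise distinct $p_j\in(-\pi,\pi]$ with $e^{\mathrm iNp_j}=(-1)^{\xi+1}$. Then for each of these vectors (XY, in either parametrization, and XX) the expectation value $\langle X_n\rangle=\langle\Psi|X_n|\Psi\rangle$ does not depend on $n$, and is given by the same formula $$\langle X_n\rangle = 1-\frac4N\sum_{j=1}^M\sin^2p_j\qquad(n=1,\dots,N).$$ In terms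 of Bethe roots, $\langle\Psi_M(\mathbf u)|X_n|\Psi_M(\mathbf u)\rangle=1+\frac1N\sum_{j=1}^M\mathcal Y(u_j)$ with $\mathcal Y(u)=r(u)^{-2}+r(u)^2-2$. Moreover, for the XY states in either parametrization, $$\langle\sigma^x_1\sigma^y_2\rangle=1-\frac{2M}{N}.$$ -/

import Mathlib

open scoped Matrix

noncomputable section

namespace ChiralXY

/-! ### Jacobi theta functions (nome `q = exp (π i τ)`, arguments rescaled by `π`) -/

/-- `θ₁(u) = 2 ∑_{n ≥ 0} (-1)^n q^((n+1/2)^2) sin ((2n+1) π u)`; see `theta1_eq_tsum`. -/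
def theta1 (τ u : ℂ) : ℂ :=
  -Complex.I * Complex.exp (Real.pi * Complex.I * (τ / 4 + u)) *
    jacobiTheta₂ (u + τ / 2 + 1 / 2) τ

/-- `θ₃(u) = 1 + 2 ∑_{n ≥ 1} q^(n^2) cos (2 n π u)`; see `theta3_eq_tsum`. -/
def theta3 (τ u : ℂ) : ℂ := jacobiTheta₂ u τ

/-- `θ₄(u) = 1 + 2 ∑_{n ≥ 1} (-1)^n q^(n^2) cos (2 n π u)`; see `theta4_eq_tsum`. -/
def theta4 (τ u : ℂ) : ℂ := jacobiTheta₂ (u + 1 / 2) τ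

theorem theta1_eq_tsum {τ : ℂ} (hτ : 0 < τ.im) (u : ℂ) :
    theta1 τ u = 2 * ∑' n : ℕ, (-1 : ℂ) ^ n *
      Complex.exp (Real.pi * Complex.I * τ * ((n : ℂ) + 1 / 2) ^ 2) *
        Complex.sin ((2 * n + 1) * Real.pi * u) := by
  have h := (hasSum_jacobiTheta₂_term (u + τ / 2 + 1 / 2) hτ).nat_add_neg_add_one
  rw [theta1, ← h.tsum_eq, ← tsum_mul_left, ← tsum_mul_left]
  congr 1
  ext n
  have e1 : (-1 : ℂ) ^ n = Complex.exp (Real.pi * Complex.I * n) := by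
    rw [mul_comm, Complex.exp_nat_mul, Complex.exp_pi_mul_I]
  have e2 : jacobiTheta₂_term n (u + τ / 2 + 1 / 2) τ =
      Complex.exp (Real.pi * Complex.I * n) *
        Complex.exp (2 * Real.pi * Complex.I * n * (u + τ / 2) +
          Real.pi * Complex.I * n ^ 2 * τ) := by
    rw [jacobiTheta₂_term, ← Complex.exp_add]
    congr 1
    push_cast
    ring
  have e3 : jacobiTheta₂_term (-(n + 1 : ℤ)) (u + τ / 2 + 1 / 2) τ =
      -Complex.exp (Real.pi * Complex.I * n) *
        Complex.exp (-2 * Real.pi * Complex.I * (n + 1) * (u + τ / 2) +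
          Real.pi * Complex.I * (n + 1) ^ 2 * τ) := by
    have : -Complex.exp (Real.pi * Complex.I * n) =
        Complex.exp (-(Real.pi * Complex.I * (n + 1))) := by
      rw [Complex.exp_neg, mul_add, Complex.exp_add, mul_one, Complex.exp_pi_mul_I, ← e1,
        mul_neg_one, inv_neg, ← inv_pow, inv_neg, inv_one]
    rw [jacobiTheta₂_term, this, ← Complex.exp_add]
    congr 1
    push_cast
    ring
  rw [e2, e3, e1, Complex.sin]
  generalize Complex.exp (Real.pi * Complex.I * n) = s
  rw [show ∀ a b c d : ℂ, 2 * (s * a * ((b - c) * d / 2)) = s * d * (a * b - a * c) * 1 by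
      intros; ring, ← Complex.exp_add, ← Complex.exp_add,
    show ∀ a b c d : ℂ, -d * a * (s * b + -s * c) = s * d * (a * c - a * b) * 1 by
      intros; ring, ← Complex.exp_add, ← Complex.exp_add]
  ring_nf

theorem theta3_eq_tsum {τ : ℂ} (hτ : 0 < τ.im) (u : ℂ) :
    theta3 τ u = 1 + 2 * ∑' n : ℕ,
      Complex.exp (Real.pi * Complex.I * τ * ((n : ℂ) + 1) ^ 2) *
        Complex.cos (2 * (n + 1) * Real.pi * u) := by
  have h := (hasSum_jacobiTheta₂_term u hτ).nat_add_neg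
  have h2 := (h.summable.hasSum.unique h)
  rw [h.summable.tsum_eq_zero_add] at h2
  have h0 : jacobiTheta₂_term 0 u τ = 1 := by simp [jacobiTheta₂_term]
  rw [theta3, ← tsum_mul_left]
  have h3 : ∀ n : ℕ, jacobiTheta₂_term ((n + 1 : ℕ) : ℤ) u τ +
      jacobiTheta₂_term (-((n + 1 : ℕ) : ℤ)) u τ =
      2 * (Complex.exp (Real.pi * Complex.I * τ * ((n : ℂ) + 1) ^ 2) *
        Complex.cos (2 * (n + 1) * Real.pi * u)) := by
    intro n
    rw [Complex.cos, jacobiTheta₂_term, jacobiTheta₂_term]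
    push_cast
    rw [show ∀ a b c : ℂ, 2 * (a * ((b + c) / 2)) = a * b + a * c by intros; ring,
      ← Complex.exp_add, ← Complex.exp_add]
    congr 2 <;> ring
  simp only [h3] at h2
  simp only [Nat.cast_zero, neg_zero, h0] at h2
  linear_combination -h2

theorem theta4_eq_tsum {τ : ℂ} (hτ : 0 < τ.im) (u : ℂ) :
    theta4 τ u = 1 + 2 * ∑' n : ℕ, (-1 : ℂ) ^ (n + 1) *
      Complex.exp (Real.pi * Complex.I * τ * ((n : ℂ) + 1) ^ 2) *
        Complex.cos (2 * (n + 1) * Real.pi * u) := by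
  have h := theta3_eq_tsum hτ (u + 1 / 2)
  rw [theta3] at h
  rw [theta4, h]
  congr 3
  ext n
  have : (2 * ((n : ℂ) + 1) * Real.pi * (u + 1 / 2)) =
      2 * (n + 1) * Real.pi * u + ((n + 1 : ℕ) : ℂ) * Real.pi := by push_cast; ring
  rw [this, Complex.cos_antiperiodic.add_nat_mul_eq]
  ring

/-! ### The spin chain

Sites are labelled by `Fin N`; the element `i : Fin N` is the site number `i + 1` of the chain
`1, …, N`, and addition in `Fin N` implements the periodic boundary conditions. The basis vectors
`0, 1 : Fin 2` of a qubit are the eigenvectors of `σ^z` with eigenvalues `+1, -1`. A vector of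
`(ℂ²)^{⊗ N}` is given by its coordinates in the product basis. -/

/-- The index set of the computational product basis of `(ℂ²)^{⊗ N}`. -/
abbrev Config (N : ℕ) : Type := Fin N → Fin 2

/-- The one-site operator acting as `A` on site `n` and as the identity on all other sites. -/
def siteOp {N : ℕ} (A : Matrix (Fin 2) (Fin 2) ℂ) (n : Fin N) :
    Matrix (Config N) (Config N) ℂ :=
  Matrix.of fun s t => if ∀ m, m ≠ n → s m = t m then A (s n) (t n) else 0

/-- `σ^x_n`. -/
def sigmaX {N : ℕ} (n : Fin N) : Matrix (Config N) (Config N) ℂ := siteOp !![0, 1; 1, 0] n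

/-- `σ^y_n`. -/
def sigmaY {N : ℕ} (n : Fin N) : Matrix (Config N) (Config N) ℂ :=
  siteOp !![0, -Complex.I; Complex.I, 0] n

/-- `X_n = σ^x_n σ^y_{n+1} - σ^y_n σ^x_{n+1}`. -/
def currentOp {N : ℕ} [NeZero N] (n : Fin N) : Matrix (Config N) (Config N) ℂ :=
  sigmaX n * sigmaY (n + 1) - sigmaY n * sigmaX (n + 1)

/-- `⟨Ψ| A |Ψ⟩`. -/
def expect {N : ℕ} (Ψ : Config N → ℂ) (A : Matrix (Config N) (Config N) ℂ) : ℂ :=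
  star Ψ ⬝ᵥ (A *ᵥ Ψ)

/-! ### The chiral basis -/

/-- `ψ(k) = (1, i^k) / √2`. -/
def psi (k : ℤ) : Fin 2 → ℂ :=
  ![1 / (Real.sqrt 2 : ℂ), Complex.I ^ k / (Real.sqrt 2 : ℂ)]

/-- The chiral basis vector `|κ; n₁, …, n_M⟩`: the product vector with factor
`ψ(l - 2 #{j : n_j < l} - κ)` at site `l`, times `(-i)^{n₁ + ⋯ + n_M}`. -/
def chiralVec {N M : ℕ} (κ : ℤˣ) (n : Fin M ↪o Fin N) : Config N → ℂ := fun s =>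
  (-Complex.I) ^ (∑ j, ((n j : ℕ) + 1)) *
    ∏ l : Fin N,
      psi (((l : ℕ) : ℤ) + 1 - 2 * (Finset.univ.filter fun j => n j < l).card - (κ : ℤ)) (s l)

/-- The number `M` of kinks is admissible for a chain of `N` sites: `N` is even, `0 ≤ M ≤ N`, and
`M` has the parity of `N / 2`. -/
def Admissible (N M : ℕ) : Prop := Even N ∧ M ≤ N ∧ M ≡ N / 2 [MOD 2]

/-- The vector `∑_{n₁ < ⋯ < n_M} ∑_{κ = ± 1} χ_n κ^ξ |κ; n⟩` with
`χ_n = (2 N^M)^{-1/2} det (A_{n_j}(l))_{j,l}`, for given one-kink amplitudes `A_n(l)`,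
`1 ≤ n ≤ N`, `l = 1, …, M`. -/
def chiralState (N : ℕ) {M : ℕ} (ξ : Fin 2) (A : ℕ → Fin M → ℂ) : Config N → ℂ :=
  ∑ n : Fin M ↪o Fin N, ∑ κ : ℤˣ,
    ((1 / (Real.sqrt (2 * (N : ℝ) ^ M) : ℂ)) *
      (Matrix.of fun j l : Fin M => A ((n j : ℕ) + 1) l).det *
        (((κ : ℤ) : ℂ) ^ (ξ : ℕ))) • chiralVec κ n

/-! ### XY eigenstates in terms of Bethe roots -/

/-- `r(u) = θ₁(u + 1/4) / θ₁(u - 1/4)`, which equals `exp (i p(u))` for the quasi-momentum `p(u)`. -/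
def momentumRatio (τ u : ℂ) : ℂ := theta1 τ (u + 1 / 4) / theta1 τ (u - 1 / 4)

/-- `A_n(u) = r(u)^n (θ₃(u + ε_n/4) / θ₃(u - ε_n/4))^{1/2}`, `ε_n = (-1)^n`
(principal branch of the square root). -/
def amplitude (τ : ℂ) (n : ℕ) (u : ℂ) : ℂ :=
  momentumRatio τ u ^ n *
    (theta3 τ (u + (-1) ^ n / 4) / theta3 τ (u - (-1) ^ n / 4)) ^ (1 / 2 : ℂ)

/-- The fundamental domain for the Bethe roots. -/
def InRootDomain (τ u : ℂ) : Prop :=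
  (-(1 / 2) < u.re ∧ u.re ≤ 0 ∧ -(τ.im / 2) < u.im ∧ u.im ≤ τ.im / 2) ∨
    (0 < u.re ∧ u.re ≤ 1 / 2 ∧ -(τ.im / 2) ≤ u.im ∧ u.im < τ.im / 2)

/-- `u₁, …, u_M` are pairwise distinct Bethe roots of the sector `ξ` in the fundamental domain:
`r(u_j)^N = (-1)^{ξ+1}`. -/
def IsBetheRoots (N : ℕ) {M : ℕ} (τ : ℂ) (ξ : Fin 2) (u : Fin M → ℂ) : Prop :=
  Function.Injective u ∧
    ∀ j, InRootDomain τ (u j) ∧ momentumRatio τ (u j) ^ N = (-1) ^ ((ξ : ℕ) + 1)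

/-- The chiral XY eigenstate `|Ψ_M(u)⟩`. -/
def xyState (N : ℕ) {M : ℕ} (τ : ℂ) (ξ : Fin 2) (u : Fin M → ℂ) : Config N → ℂ :=
  chiralState N ξ fun n l => amplitude τ n (u l)

/-- `Y(u) = r(u)^{-2} + r(u)^2 - 2`. -/
def calY (τ u : ℂ) : ℂ :=
  (theta1 τ (u - 1 / 4) / theta1 τ (u + 1 / 4)) ^ 2 +
    (theta1 τ (u + 1 / 4) / theta1 τ (u - 1 / 4)) ^ 2 - 2

/-! ### XY and XX eigenstates in terms of quasi-momenta -/

/-- `p₁, …, p_M ∈ (a, a + 2π]` are pairwise distinct quasi-momenta of the sector `ξ`: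
`exp (i N p_j) = (-1)^{ξ+1}`. -/
def IsQuasiMomenta (N : ℕ) {M : ℕ} (a : ℝ) (ξ : Fin 2) (p : Fin M → ℝ) : Prop :=
  Function.Injective p ∧
    ∀ j, p j ∈ Set.Ioc a (a + 2 * Real.pi) ∧
      Complex.exp (Complex.I * N * p j) = (-1) ^ ((ξ : ℕ) + 1)

/-- `φ(p) = (1/2) arctan ((J_x - J_y) / (J_x + J_y) tan p)`, with the value `π/4` at the points
where `tan p` is infinite. -/
def phi (Jx Jy p : ℝ) : ℝ :=
  if Real.cos p = 0 then Real.pi / 4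
  else 1 / 2 * Real.arctan ((Jx - Jy) / (Jx + Jy) * Real.tan p)

/-- The chiral XY eigenstate in the quasi-momentum representation, with one-kink amplitudes
`exp (i (n p - (-1)^n φ(p)))`. -/
def xyMomentumState (N : ℕ) {M : ℕ} (Jx Jy : ℝ) (ξ : Fin 2) (p : Fin M → ℝ) : Config N → ℂ :=
  chiralState N ξ fun n l =>
    Complex.exp (Complex.I * ((n * p l - (-1) ^ n * phi Jx Jy (p l) : ℝ) : ℂ))

/-- The chiral XX eigenstate, with one-kink amplitudes `exp (i n p)`. -/
def xxState (N : ℕ) {M : ℕ} (ξ : Fin 2) (p : Fin M → ℝ) : Config N → ℂ :=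
  chiralState N ξ fun n l => Complex.exp (Complex.I * ((n * p l : ℝ) : ℂ))

end ChiralXY

end

noncomputable section

namespace ChiralXY

/-! The kinks of the chiral basis are free fermions. Neighbouring phases of a basis vector differ by
±1, and the two products in X_n act on two neighbouring factors of opposite parity: one product
fixes both factors, the other adds 2 to both phases, up to a common sign. Adding 2 at the sites n
and n+1 toggles the kinks n-1 and n+1. Hence X_n = (1-2b_n)(1 - T_n), where b_n counts the kink at n
and T_n toggles the kinks n-1 and n+1 (`currentOp_mulVec_kinkVec`). Admissibility, i.e. 4 ∣ N-2M,
lets the phases close up around the ring, and the basis vectors with M kinks are orthonormal.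

The amplitudes are Slater determinants. When the orbitals are orthogonal of squared norm N,
Cauchy–Binet gives the one-particle density matrix (1/N) ∑_l conj(a_x(l)) a_y(l). The diagonal part
of X_n then contributes 1-2M/N, since |A_n(l)| = 1. In the hopping part the fermionic sign of a kink
at n cancels 1-2b_n, and the phases (-i)^{n_j} supply -1 (`hop_sign`). What remains is (1/N) ∑ (z_l²
+ z_l⁻²) with z_l = e^{ip_l}. A hop across the seam changes κ; its sign, together with κ^ξ, is
compensated by z_l^N = (-1)^{ξ+1}. Adding the parts gives 1 + (1/N) ∑ (z_l² + z_l⁻² - 2) = 1 - (4/N)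
∑ sin² p_l. At the first site σ^xσ^y is purely diagonal and yields 1-2M/N.

All three families therefore reduce to `IsUnimodularAmplitude`: A_n(l) = z_l^n s_n(l) with distinct
unimodular z_l and unimodular s of period 2 in n, equal for opposite z. The last property gives
orthogonality in the only case, z' = -z, in which the geometric sum over pairs of sites does not
vanish.

For Bethe roots this requires theta function theory with τ = it. A bilinear identity turns r(u) =
r(v) into the vanishing of one of two theta functions of period 2τ. Taking v = -ū shows that |r(u)|
= 1 forces Re u into {0, 1/2} on the domain; taking two roots shows that r is injective there. Only
zeros on certain lines are needed, and these are found by elementary means. -/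

open Complex in
/-- Splitting the double series of `θ₃(x|τ) θ₃(y|τ)` by the parity of `m + n`. -/
theorem jacobiTheta₂_mul (x y : ℂ) {τ : ℂ} (hτ : 0 < τ.im) :
    jacobiTheta₂ x τ * jacobiTheta₂ y τ =
      jacobiTheta₂ (x + y) (2 * τ) * jacobiTheta₂ (x - y) (2 * τ) +
        exp (2 * Real.pi * I * x + Real.pi * I * τ) *
          (jacobiTheta₂ (x + y + τ) (2 * τ) * jacobiTheta₂ (x - y + τ) (2 * τ)) := by
  have h2τ : 0 < (2 * τ).im := by simpa using hτ
  have hn (z : ℂ) {τ : ℂ} (hτ : 0 < τ.im) : Summable fun n => ‖jacobiTheta₂_term n z τ‖ :=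
    ((summable_jacobiTheta₂_term_iff z τ).2 hτ).norm
  have hp (z w : ℂ) {τ : ℂ} (hτ : 0 < τ.im) :
      HasSum (fun p : ℤ × ℤ => jacobiTheta₂_term p.1 z τ * jacobiTheta₂_term p.2 w τ)
        (jacobiTheta₂ z τ * jacobiTheta₂ w τ) := by
    rw [jacobiTheta₂, jacobiTheta₂, tsum_mul_tsum_of_summable_norm (hn z hτ) (hn w hτ)]
    exact (summable_mul_of_summable_norm (hn z hτ) (hn w hτ)).hasSum
  let e : (ℤ × ℤ) ⊕ (ℤ × ℤ) → ℤ × ℤ :=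
    Sum.elim (fun p => (p.1 + p.2, p.1 - p.2)) (fun p => (p.1 + p.2 + 1, p.1 - p.2))
  have he : Function.Bijective e := by
    constructor
    · rintro (⟨a, b⟩ | ⟨a, b⟩) (⟨c, d⟩ | ⟨c, d⟩) h <;>
        simp only [e, Sum.elim_inl, Sum.elim_inr, Prod.mk.injEq] at h <;>
        first
          | (exfalso; omega)
          | (congr 2 <;> omega)
    · rintro ⟨m, n⟩
      rcases Int.even_or_odd' (m + n) with ⟨c, hc | hc⟩
      · exact ⟨Sum.inl (c, m - c), by simp only [e, Sum.elim_inl, Prod.mk.injEq]; omega⟩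
      · exact ⟨Sum.inr (c, m - c - 1), by simp only [e, Sum.elim_inr, Prod.mk.injEq]; omega⟩
  refine ((Equiv.ofBijective e he).hasSum_iff.2 (hp x y hτ)).unique ?_
  refine HasSum.sum ?_ ?_
  · convert! hp (x + y) (x - y) h2τ using 2 with p
    simp only [Function.comp_apply, Equiv.ofBijective_apply, e, Sum.elim_inl, jacobiTheta₂_term,
      ← exp_add]
    congr 1
    push_cast
    ring
  · convert! (hp (x + y + τ) (x - y + τ) h2τ).mul_left
      (exp (2 * Real.pi * I * x + Real.pi * I * τ)) using 2 with p
    simp only [Function.comp_apply, Equiv.ofBijective_apply, e, Sum.elim_inr, jacobiTheta₂_term,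
      ← exp_add]
    congr 1
    push_cast
    ring

/-! ### Zeros of theta functions on real and imaginary lines -/

theorem im_mul_I_pos {t : ℝ} (ht : 0 < t) : 0 < ((t : ℂ) * Complex.I).im := by simpa using ht

/-- On the imaginary axis every term of the series is a positive real exponential. -/
theorem jacobiTheta₂_imaginary_ne_zero (y : ℝ) {t : ℝ} (ht : 0 < t) :
    jacobiTheta₂ (y * Complex.I) (t * Complex.I) ≠ 0 := by
  have hterm (n : ℤ) : jacobiTheta₂_term n (y * Complex.I) (t * Complex.I) =
      ((Real.exp (-(2 * Real.pi * n * y) - Real.pi * n ^ 2 * t) : ℝ) : ℂ) := by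
    rw [jacobiTheta₂_term, Complex.ofReal_exp]
    congr 1
    push_cast
    linear_combination (2 * Real.pi * n * y + Real.pi * n ^ 2 * t) * Complex.I_mul_I
  have hs := (summable_jacobiTheta₂_term_iff (y * Complex.I) (t * Complex.I)).2 (im_mul_I_pos ht)
  simp only [hterm] at hs
  rw [jacobiTheta₂, tsum_congr hterm, ← Complex.ofReal_tsum, Complex.ofReal_ne_zero]
  exact ((Complex.summable_ofReal.1 hs).tsum_pos (fun _ => (Real.exp_pos _).le) 0
    (Real.exp_pos _)).ne'

/-- The modular inversion τ ↦ -1/τ has a nonvanishing prefactor. It exchanges the real and imaginary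
directions. -/
theorem jacobiTheta₂_eq_zero_iff_inv (z : ℂ) {t : ℝ} (ht : 0 < t) :
    jacobiTheta₂ z (t * Complex.I) = 0 ↔
      jacobiTheta₂ (z / (t * Complex.I)) ((t⁻¹ : ℝ) * Complex.I) = 0 := by
  have ht' : (t : ℂ) ≠ 0 := by exact_mod_cast ht.ne'
  have h1 : -Complex.I * (t * Complex.I) = t := by
    linear_combination -(t : ℂ) * Complex.I_mul_I
  have h2 : -1 / (t * Complex.I) = ((t⁻¹ : ℝ) : ℂ) * Complex.I := by
    push_cast
    field_simp
    linear_combination -Complex.I_sq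
  rw [jacobiTheta₂_functional_equation z, h1, h2]
  simp [ht', Complex.exp_ne_zero]

theorem jacobiTheta₂_half_ne_zero {t : ℝ} (ht : 0 < t) :
    jacobiTheta₂ (1 / 2) (t * Complex.I) ≠ 0 := by
  have ht' : (t : ℂ) ≠ 0 := by exact_mod_cast ht.ne'
  have e : 1 / 2 / (t * Complex.I) = ((-(1 / (2 * t)) : ℝ) : ℂ) * Complex.I := by
    push_cast
    field_simp
    linear_combination Complex.I_sq
  rw [Ne, jacobiTheta₂_eq_zero_iff_inv _ ht, e]
  exact jacobiTheta₂_imaginary_ne_zero _ (inv_pos.2 ht)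

/-- The zero of `θ₃` at `(1 + τ) / 2`. -/
theorem jacobiTheta₂_half_add_half_period (τ : ℂ) : jacobiTheta₂ (1 / 2 + τ / 2) τ = 0 := by
  -- Translation by τ from (1-τ)/2 has multiplier -1, while evenness and period 1 identify the two
  -- values; so the value is its own negative.
  have h := jacobiTheta₂_add_left' (1 / 2 - τ / 2) τ
  have e1 : -Real.pi * Complex.I * (τ + 2 * (1 / 2 - τ / 2)) = -(Real.pi * Complex.I) := by ring
  rw [e1, Complex.exp_neg, Complex.exp_pi_mul_I, ← jacobiTheta₂_neg_left (1 / 2 - τ / 2),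
    show (1 / 2 - τ / 2 + τ : ℂ) = 1 / 2 + τ / 2 by ring, ← jacobiTheta₂_add_left (-(1 / 2 - τ / 2)),
    show -(1 / 2 - τ / 2) + 1 = 1 / 2 + τ / 2 by ring] at h
  have : (2 : ℂ) * jacobiTheta₂ (1 / 2 + τ / 2) τ = 0 := by linear_combination h
  simpa using this

/-- Landen's transformation: for arguments differing by 1/2, the second product in
`jacobiTheta₂_mul` contains the zero at the half period of 2τ. -/
theorem jacobiTheta₂_duplication (z : ℂ) {τ : ℂ} (hτ : 0 < τ.im) :
    jacobiTheta₂ (z + 1 / 2) τ * jacobiTheta₂ z τ =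
      jacobiTheta₂ (2 * z + 1 / 2) (2 * τ) * jacobiTheta₂ (1 / 2) (2 * τ) := by
  rw [jacobiTheta₂_mul _ _ hτ, show z + 1 / 2 - z + τ = 1 / 2 + 2 * τ / 2 by ring,
    jacobiTheta₂_half_add_half_period]
  ring_nf

theorem abs_sin_nat_mul_le (k : ℕ) (a : ℝ) : |Real.sin (k * a)| ≤ k * |Real.sin a| := by
  induction k with
  | zero => simp
  | succ k ih =>
    have h : Real.sin ((k + 1 : ℕ) * a) =
        Real.sin (k * a) * Real.cos a + Real.cos (k * a) * Real.sin a := by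
      rw [← Real.sin_add]
      push_cast
      ring_nf
    rw [h]
    have h1 := abs_add_le (Real.sin (k * a) * Real.cos a) (Real.cos (k * a) * Real.sin a)
    rw [abs_mul, abs_mul] at h1
    have h2 := mul_le_mul_of_nonneg_left (Real.abs_cos_le_one a) (abs_nonneg (Real.sin (k * a)))
    have h3 := mul_le_mul_of_nonneg_right (Real.abs_cos_le_one (k * a)) (abs_nonneg (Real.sin a))
    push_cast
    linarith

/-- For t ≥ 1 the first term of the sine series dominates: the bound |sin((2n+1)a)| ≤ (2n+1)|sin a|
makes the n-th term at most 4⁻ⁿ times the first, so the tail is at most a third of it. A zero of the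
sum is thus a zero of the first term. -/
theorem theta1_ne_zero_of_one_le {x t : ℝ} (ht : 1 ≤ t) (h : theta1 (t * Complex.I) x = 0) :
    Real.sin (Real.pi * x) = 0 := by
  rw [theta1_eq_tsum (im_mul_I_pos (by linarith))] at h
  set c : ℕ → ℂ := fun n => (-1 : ℂ) ^ n *
    Complex.exp (Real.pi * Complex.I * (t * Complex.I) * ((n : ℂ) + 1 / 2) ^ 2) *
      Complex.sin ((2 * n + 1) * Real.pi * x) with hc
  have hnorm (n : ℕ) : ‖c n‖ = Real.exp (-(Real.pi * t * (n + 1 / 2) ^ 2)) *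
      |Real.sin ((2 * n + 1 : ℕ) * (Real.pi * x))| := by
    have e1 : Real.pi * Complex.I * (t * Complex.I) * ((n : ℂ) + 1 / 2) ^ 2 =
        ((-(Real.pi * t * (n + 1 / 2) ^ 2) : ℝ) : ℂ) := by
      push_cast
      linear_combination (Real.pi * t * ((n : ℂ) + 1 / 2) ^ 2) * Complex.I_mul_I
    have e2 : (2 * (n : ℂ) + 1) * Real.pi * x = (((2 * n + 1 : ℕ) * (Real.pi * x) : ℝ) : ℂ) := by
      push_cast
      ring
    simp only [hc]
    rw [e1, e2, ← Complex.ofReal_exp, ← Complex.ofReal_sin, norm_mul, norm_mul, norm_pow, norm_neg,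
      norm_one, one_pow, one_mul, Complex.norm_real, Complex.norm_real, Real.norm_eq_abs,
      Real.norm_eq_abs, Real.abs_exp]
  -- The factor 1/12 absorbs 2n+1 ≤ 3ⁿ and leaves the ratio 1/4.
  have hq : Real.exp (-(Real.pi * t)) ≤ 1 / 12 := by
    have h3 : (12 : ℝ) ≤ Real.exp 3 := by
      have := Real.exp_one_gt_d9
      have e : Real.exp 3 = Real.exp 1 ^ 3 := by rw [← Real.exp_nat_mul]; norm_num
      rw [e]
      calc (12 : ℝ) ≤ 2.7 ^ 3 := by norm_num
        _ ≤ _ := by gcongr; linarith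
    have h4 : Real.exp 3 ≤ Real.exp (Real.pi * t) :=
      Real.exp_le_exp.2 (by nlinarith [Real.pi_gt_three])
    rw [Real.exp_neg, ← one_div]
    exact one_div_le_one_div_of_le (by norm_num) (h3.trans h4)
  have hbound (n : ℕ) : ‖c n‖ ≤ ‖c 0‖ * (1 / 4) ^ n := by
    rw [hnorm, hnorm]
    have h1 := abs_sin_nat_mul_le (2 * n + 1) (Real.pi * x)
    have h2 : Real.exp (-(Real.pi * t * (n + 1 / 2) ^ 2)) ≤
        Real.exp (-(Real.pi * t * (0 + 1 / 2) ^ 2)) * (1 / 12) ^ n := by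
      calc _ ≤ Real.exp (-(Real.pi * t * (0 + 1 / 2) ^ 2) + n * -(Real.pi * t)) := by
            apply Real.exp_le_exp.2
            have : 0 ≤ Real.pi * t * (n : ℝ) ^ 2 := by positivity
            nlinarith
        _ ≤ _ := by
            rw [Real.exp_add, Real.exp_nat_mul]
            gcongr
    have h3 : ((2 * n + 1 : ℕ) : ℝ) ≤ 3 ^ n := by
      have := one_add_mul_le_pow (show (-2 : ℝ) ≤ 2 by norm_num) n
      push_cast
      norm_num at this
      linarith
    calc _ ≤ (Real.exp (-(Real.pi * t * (0 + 1 / 2) ^ 2)) * (1 / 12) ^ n) *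
          (3 ^ n * |Real.sin (Real.pi * x)|) := by
            gcongr
            exact h1.trans (by gcongr)
      _ = _ := by
            rw [show (1 / 4 : ℝ) = 1 / 12 * 3 by norm_num, mul_pow]
            norm_num
            ring
  have hgeo : Summable fun n : ℕ => ‖c 0‖ * (1 / 4 : ℝ) ^ n :=
    (summable_geometric_of_lt_one (by norm_num) (by norm_num)).mul_left _
  have hsum : Summable c := Summable.of_norm_bounded hgeo hbound
  have hz : ∑' n, c n = 0 := by simpa using h
  rw [hsum.tsum_eq_zero_add] at hz
  have h0 : ‖c 0‖ ≤ ‖c 0‖ * (1 / 3) := by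
    calc ‖c 0‖ = ‖∑' n, c (n + 1)‖ := by rw [eq_neg_of_add_eq_zero_left hz, norm_neg]
      _ ≤ ∑' n : ℕ, ‖c 0‖ * (1 / 4) * (1 / 4) ^ n := by
          refine tsum_of_norm_bounded (Summable.hasSum ?_) fun n => ?_
          · exact (summable_geometric_of_lt_one (by norm_num) (by norm_num)).mul_left _
          · exact (hbound (n + 1)).trans_eq (by ring)
      _ = _ := by
          rw [tsum_mul_left, tsum_geometric_of_lt_one (by norm_num) (by norm_num)]
          ring
  have h1 : ‖c 0‖ = 0 := by nlinarith [norm_nonneg (c 0)]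
  rw [hnorm] at h1
  simpa [Real.exp_ne_zero] using h1

theorem theta1_eq_zero_iff (τ u : ℂ) :
    theta1 τ u = 0 ↔ jacobiTheta₂ (u + τ / 2 + 1 / 2) τ = 0 := by
  simp [theta1, Complex.exp_ne_zero]

/-- The real zeros of `θ₁(·|it)` are the integers. -/
theorem exists_int_of_theta1_eq_zero {x t : ℝ} (ht : 0 < t) (h : theta1 (t * Complex.I) x = 0) :
    ∃ m : ℤ, x = m := by
  -- Duplication sends a zero x for t to a zero 2x for 2t; k doublings reach the range t ≥ 1.
  obtain ⟨k, hk⟩ := pow_unbounded_of_one_lt t⁻¹ (one_lt_two (α := ℝ))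
  replace hk : 1 ≤ 2 ^ k * t := by
    have := mul_le_mul_of_nonneg_right hk.le ht.le
    rwa [inv_mul_cancel₀ ht.ne'] at this
  induction k generalizing x t with
  | zero =>
    have h1 := theta1_ne_zero_of_one_le (by simpa using hk) h
    obtain ⟨m, hm⟩ := Real.sin_eq_zero_iff.1 h1
    exact ⟨m, mul_left_cancel₀ Real.pi_ne_zero (by rw [← hm, mul_comm])⟩
  | succ k ih =>
    have h0 := (theta1_eq_zero_iff _ _).1 h
    have hd := jacobiTheta₂_duplication (x + t * Complex.I / 2) (im_mul_I_pos ht)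
    rw [h0, zero_mul] at hd
    have e2 : 2 * ((t : ℂ) * Complex.I) = ((2 * t : ℝ) : ℂ) * Complex.I := by push_cast; ring
    rw [e2] at hd
    have h2 : theta1 ((2 * t : ℝ) * Complex.I) (2 * x : ℝ) = 0 := by
      rw [theta1_eq_zero_iff]
      rcases mul_eq_zero.1 hd.symm with h3 | h3
      · convert! h3 using 2
        push_cast
        ring
      · exact absurd h3 (jacobiTheta₂_half_ne_zero (by linarith))
    obtain ⟨m, hm⟩ := ih (by linarith) h2 (by rw [pow_succ] at hk; linarith)
    rcases Int.even_or_odd' m with ⟨c, rfl | rfl⟩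
    · exact ⟨c, by push_cast at hm; linarith⟩
    · exfalso
      -- Halving might leave a half-integer, but there θ₁ is up to a nonzero factor θ₃ on the
      -- imaginary axis, which does not vanish.
      have hx : x = c + 1 / 2 := by push_cast at hm; linarith
      have hper := (show Function.Periodic (fun z => jacobiTheta₂ z (t * Complex.I)) 1 from
        fun z => jacobiTheta₂_add_left z _).int_mul (c + 1) (((t / 2 : ℝ) : ℂ) * Complex.I)
      refine jacobiTheta₂_imaginary_ne_zero (t / 2) ht ?_
      rw [← hper, ← h0, hx]
      congr 1
      push_cast
      ring

/-- The zeros of `θ₄(·|it)` on the imaginary axis. -/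
theorem exists_int_of_jacobiTheta₂_half_add_eq_zero {y t : ℝ} (ht : 0 < t)
    (h : jacobiTheta₂ (1 / 2 + y * Complex.I) (t * Complex.I) = 0) :
    ∃ m : ℤ, y / t + 1 / 2 = m := by
  rw [jacobiTheta₂_eq_zero_iff_inv _ ht, ← jacobiTheta₂_neg_left] at h
  have ht' : (t : ℂ) ≠ 0 := by exact_mod_cast ht.ne'
  -- After inversion and a sign change the point has the form x + τ'/2 + 1/2 with x real and τ' =
  -- i/t, so it is a real zero of θ₁.
  obtain ⟨m, hm⟩ := exists_int_of_theta1_eq_zero (x := -(y / t + 1 / 2)) (inv_pos.2 ht) (by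
    rw [theta1_eq_zero_iff, ← h]
    congr 1
    push_cast
    field_simp
    linear_combination Complex.I_sq)
  exact ⟨-m, by push_cast; linarith⟩

theorem jacobiTheta₂_quarter_mul_ne_zero (y : ℝ) {t : ℝ} (ht : 0 < t) :
    jacobiTheta₂ (y * Complex.I + 1 / 4) (t * Complex.I) *
      jacobiTheta₂ (y * Complex.I - 1 / 4) (t * Complex.I) ≠ 0 := by
  have h := jacobiTheta₂_duplication (y * Complex.I - 1 / 4) (im_mul_I_pos ht)
  have e2 : 2 * ((t : ℂ) * Complex.I) = ((2 * t : ℝ) : ℂ) * Complex.I := by push_cast; ring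
  rw [e2, show (y * Complex.I - 1 / 4 + 1 / 2 : ℂ) = y * Complex.I + 1 / 4 by ring,
    show 2 * (y * Complex.I - 1 / 4) + 1 / 2 = ((2 * y : ℝ) : ℂ) * Complex.I by
      push_cast; ring] at h
  rw [h]
  exact mul_ne_zero (jacobiTheta₂_imaginary_ne_zero _ (by linarith))
    (jacobiTheta₂_half_ne_zero (by linarith))

/-! ### Symmetries and the bilinear identity -/

theorem theta1_add_one (τ u : ℂ) : theta1 τ (u + 1) = -theta1 τ u := by
  rw [theta1, theta1, show u + 1 + τ / 2 + 1 / 2 = u + τ / 2 + 1 / 2 + 1 by ring,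
    jacobiTheta₂_add_left,
    show Real.pi * Complex.I * (τ / 4 + (u + 1)) =
      Real.pi * Complex.I * (τ / 4 + u) + Real.pi * Complex.I by ring, Complex.exp_add,
    Complex.exp_pi_mul_I]
  ring

theorem theta1_neg {τ : ℂ} (hτ : 0 < τ.im) (u : ℂ) : theta1 τ (-u) = -theta1 τ u := by
  rw [theta1_eq_tsum hτ, theta1_eq_tsum hτ, ← mul_neg, ← tsum_neg]
  congr 2
  ext n
  rw [mul_neg, Complex.sin_neg]
  ring

theorem theta1_conj {t : ℝ} (u : ℂ) (ht : 0 < t) :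
    (starRingEnd ℂ) (theta1 (t * Complex.I) u) =
      theta1 (t * Complex.I) ((starRingEnd ℂ) u) := by
  rw [theta1_eq_tsum (im_mul_I_pos ht), theta1_eq_tsum (im_mul_I_pos ht), map_mul,
    Complex.conj_tsum, map_ofNat]
  congr 2
  ext n
  simp only [map_mul, map_pow, map_neg, map_one, ← Complex.exp_conj, ← Complex.sin_conj, map_add,
    map_div₀, map_natCast, map_ofNat, Complex.conj_ofReal, Complex.conj_I]
  ring_nf

theorem theta3_conj {t : ℝ} (u : ℂ) :
    (starRingEnd ℂ) (theta3 (t * Complex.I) u) =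
      theta3 (t * Complex.I) ((starRingEnd ℂ) u) := by
  rw [theta3, theta3, jacobiTheta₂_conj]
  simp

/-- The bilinear theta identity behind the injectivity of `r`. -/
theorem theta1_mul_sub_theta1_mul_eq_zero {u v τ : ℂ} (hτ : 0 < τ.im)
    (h : theta1 τ (u + 1 / 4) * theta1 τ (v - 1 / 4) =
      theta1 τ (u - 1 / 4) * theta1 τ (v + 1 / 4)) :
    jacobiTheta₂ (u + v) (2 * τ) = 0 ∨ jacobiTheta₂ (u - v + 1 / 2 + τ) (2 * τ) = 0 := by
  have key (x y : ℂ) : theta1 τ x * theta1 τ y =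
      -Complex.exp (Real.pi * Complex.I * (τ / 2 + (x + y))) *
        (jacobiTheta₂ (x + y + τ) (2 * τ) * jacobiTheta₂ (x - y) (2 * τ) +
          Complex.exp (2 * Real.pi * Complex.I * (x + τ / 2 + 1 / 2) + Real.pi * Complex.I * τ) *
            Complex.exp (-Real.pi * Complex.I * (2 * τ + 2 * (x + y))) *
            (jacobiTheta₂ (x + y) (2 * τ) * jacobiTheta₂ (x - y + τ) (2 * τ))) := by
    have e := jacobiTheta₂_mul (x + τ / 2 + 1 / 2) (y + τ / 2 + 1 / 2) hτ
    rw [show x + τ / 2 + 1 / 2 + (y + τ / 2 + 1 / 2) = x + y + τ + 1 by ring,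
      show x + τ / 2 + 1 / 2 - (y + τ / 2 + 1 / 2) = x - y by ring,
      show x + y + τ + 1 + τ = x + y + 2 * τ + 1 by ring, jacobiTheta₂_add_left,
      jacobiTheta₂_add_left, jacobiTheta₂_add_left'] at e
    rw [theta1, theta1, show Real.pi * Complex.I * (τ / 2 + (x + y)) =
      Real.pi * Complex.I * (τ / 4 + x) + Real.pi * Complex.I * (τ / 4 + y) by ring,
      Complex.exp_add]
    linear_combination (Complex.I * Complex.I * Complex.exp (Real.pi * Complex.I * (τ / 4 + x)) *
      Complex.exp (Real.pi * Complex.I * (τ / 4 + y))) * e +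
      (Complex.exp (Real.pi * Complex.I * (τ / 4 + x)) *
      Complex.exp (Real.pi * Complex.I * (τ / 4 + y))) *
        (jacobiTheta₂ (x + y + τ) (2 * τ) * jacobiTheta₂ (x - y) (2 * τ) +
          Complex.exp (2 * Real.pi * Complex.I * (x + τ / 2 + 1 / 2) + Real.pi * Complex.I * τ) *
            Complex.exp (-Real.pi * Complex.I * (2 * τ + 2 * (x + y))) *
            (jacobiTheta₂ (x + y) (2 * τ) * jacobiTheta₂ (x - y + τ) (2 * τ))) * Complex.I_mul_I
  -- The two sides share x+y, and their x-y differ by the period 1. Only the exponential in the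
  -- second summand sees the difference, as a factor -1: the first summands cancel and the second
  -- ones add.
  rw [key, key, show u + 1 / 4 + (v - 1 / 4) = u + v by ring,
    show u - 1 / 4 + (v + 1 / 4) = u + v by ring,
    show u + 1 / 4 - (v - 1 / 4) = u - v - 1 / 2 + 1 by ring,
    show u - 1 / 4 - (v + 1 / 4) = u - v - 1 / 2 by ring, jacobiTheta₂_add_left,
    show u - v - 1 / 2 + 1 + τ = u - v + 1 / 2 + τ by ring,
    show u - v - 1 / 2 + τ = u - v - 1 / 2 + τ by ring,
    ← jacobiTheta₂_add_left (u - v - 1 / 2 + τ),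
    show u - v - 1 / 2 + τ + 1 = u - v + 1 / 2 + τ by ring,
    show 2 * Real.pi * Complex.I * (u + 1 / 4 + τ / 2 + 1 / 2) + Real.pi * Complex.I * τ =
      2 * Real.pi * Complex.I * (u - 1 / 4 + τ / 2 + 1 / 2) + Real.pi * Complex.I * τ +
        Real.pi * Complex.I by ring, Complex.exp_add _ (Real.pi * Complex.I),
    Complex.exp_pi_mul_I] at h
  set A := Complex.exp (Real.pi * Complex.I * (τ / 2 + (u + v)))
  set B := Complex.exp (2 * Real.pi * Complex.I * (u - 1 / 4 + τ / 2 + 1 / 2) +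
    Real.pi * Complex.I * τ)
  set C := Complex.exp (-Real.pi * Complex.I * (2 * τ + 2 * (u + v)))
  have h' : (2 * A * B * C) * (jacobiTheta₂ (u + v) (2 * τ) *
      jacobiTheta₂ (u - v + 1 / 2 + τ) (2 * τ)) = 0 := by linear_combination h
  have hne : 2 * A * B * C ≠ 0 := by simp [A, B, C, Complex.exp_ne_zero]
  exact mul_eq_zero.1 ((mul_eq_zero.1 h').resolve_left hne)

/-! ### Bethe roots and quasi-momenta as unimodular amplitudes -/

/-- One-kink amplitudes of the form `A_n(l) = z_l ^ n s_n(l)` with unimodular `z_l` and unimodular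
`2`-periodic `s_n(l)`, for which the orbitals `A(l)` are pairwise orthogonal on the chain. -/
structure IsUnimodularAmplitude (N : ℕ) {M : ℕ} (ξ : Fin 2) (z : Fin M → ℂ)
    (s A : ℕ → Fin M → ℂ) : Prop where
  eq_mul : ∀ n l, A n l = z l ^ n * s n l
  norm_z : ∀ l, ‖z l‖ = 1
  injective : Function.Injective z
  pow_eq : ∀ l, z l ^ N = (-1) ^ ((ξ : ℕ) + 1)
  norm_s : ∀ n l, ‖s n l‖ = 1
  periodic : ∀ n l, s (n + 2) l = s n l
  eq_of_neg : ∀ n l l', z l' = -z l → s n l' = s n l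

theorem momentumRatio_ne_zero_iff {τ u : ℂ} :
    momentumRatio τ u ≠ 0 ↔ theta1 τ (u + 1 / 4) ≠ 0 ∧ theta1 τ (u - 1 / 4) ≠ 0 := by
  rw [momentumRatio, div_ne_zero_iff]

theorem momentumRatio_half_sub {τ : ℂ} (hτ : 0 < τ.im) (u : ℂ) :
    momentumRatio τ (1 / 2 - u) = -momentumRatio τ u := by
  have h1 : theta1 τ (1 / 2 - u + 1 / 4) = theta1 τ (u + 1 / 4) := by
    have e := theta1_add_one τ (u - 3 / 4)
    rw [show u - 3 / 4 + 1 = u + 1 / 4 by ring] at e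
    rw [e, ← theta1_neg hτ]
    ring_nf
  have h2 : theta1 τ (1 / 2 - u - 1 / 4) = -theta1 τ (u - 1 / 4) := by
    rw [← theta1_neg hτ]
    ring_nf
  rw [momentumRatio, momentumRatio, h1, h2, div_neg]

/-- Since r(-ū) is the inverse of the conjugate of r(u), |r(u)| = 1 says r(u) = r(-ū), and the
bilinear identity applies with v = -ū. Then u+v is imaginary, where theta does not vanish, while u-v
= 2 Re u must be a real zero of θ₁(·|2it). -/
theorem exists_int_of_norm_momentumRatio_eq_one {t : ℝ} (ht : 0 < t) {u : ℂ}
    (h : ‖momentumRatio (t * Complex.I) u‖ = 1) : ∃ m : ℤ, 2 * u.re = m := by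
  have hτ := im_mul_I_pos ht
  have hne : momentumRatio (t * Complex.I) u ≠ 0 := norm_ne_zero_iff.1 (by rw [h]; exact one_ne_zero)
  obtain ⟨h1, h2⟩ := momentumRatio_ne_zero_iff.1 hne
  have hn : ‖theta1 (t * Complex.I) (u + 1 / 4)‖ = ‖theta1 (t * Complex.I) (u - 1 / 4)‖ := by
    rw [momentumRatio, norm_div, div_eq_one_iff_eq (norm_ne_zero_iff.2 h2)] at h
    exact h
  have hc : theta1 (t * Complex.I) (u + 1 / 4) *
      (starRingEnd ℂ) (theta1 (t * Complex.I) (u + 1 / 4)) =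
      theta1 (t * Complex.I) (u - 1 / 4) *
      (starRingEnd ℂ) (theta1 (t * Complex.I) (u - 1 / 4)) := by
    rw [Complex.mul_conj, Complex.mul_conj, Complex.normSq_eq_norm_sq, Complex.normSq_eq_norm_sq, hn]
  have hquarter : (starRingEnd ℂ) (1 / 4 : ℂ) = 1 / 4 := by
    rw [map_div₀, map_one, map_ofNat]
  rw [theta1_conj _ ht, theta1_conj _ ht, map_add, map_sub, hquarter] at hc
  have key := theta1_mul_sub_theta1_mul_eq_zero (u := u) (v := -(starRingEnd ℂ) u) hτ (by
    rw [show -(starRingEnd ℂ) u - 1 / 4 = -((starRingEnd ℂ) u + 1 / 4) by ring,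
      show -(starRingEnd ℂ) u + 1 / 4 = -((starRingEnd ℂ) u - 1 / 4) by ring, theta1_neg hτ,
      theta1_neg hτ]
    linear_combination -hc)
  have e2 : 2 * ((t : ℂ) * Complex.I) = ((2 * t : ℝ) : ℂ) * Complex.I := by push_cast; ring
  rw [← sub_eq_add_neg, sub_neg_eq_add, Complex.sub_conj, Complex.add_conj, e2] at key
  rcases key with h3 | h3
  · exact absurd h3 (jacobiTheta₂_imaginary_ne_zero _ (by linarith))
  · refine exists_int_of_theta1_eq_zero (t := 2 * t) (by linarith) ?_
    rw [theta1_eq_zero_iff, ← h3]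
    congr 1
    push_cast
    ring

theorem InRootDomain.re_eq {t : ℝ} (ht : 0 < t) {u : ℂ} (hu : InRootDomain (t * Complex.I) u)
    (h : ‖momentumRatio (t * Complex.I) u‖ = 1) :
    (u.re = 0 ∧ -(t / 2) < u.im ∧ u.im ≤ t / 2) ∨
      (u.re = 1 / 2 ∧ -(t / 2) ≤ u.im ∧ u.im < t / 2) := by
  obtain ⟨m, hm⟩ := exists_int_of_norm_momentumRatio_eq_one ht h
  have him : ((t : ℂ) * Complex.I).im = t := by simp
  rw [InRootDomain, him] at hu
  rcases hu with ⟨h1, h2, h3, h4⟩ | ⟨h1, h2, h3, h4⟩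
  · left
    have h5 : m = 0 := by
      have h6 : (-1 : ℝ) < m := by linarith
      have h7 : (m : ℝ) ≤ 0 := by linarith
      norm_cast at h6 h7
      omega
    rw [h5] at hm
    exact ⟨by simpa using hm, h3, h4⟩
  · right
    have h5 : m = 1 := by
      have h6 : (0 : ℝ) < m := by linarith
      have h7 : (m : ℝ) ≤ 1 := by linarith
      norm_cast at h6 h7
      omega
    rw [h5] at hm
    exact ⟨by push_cast at hm; linarith, h3, h4⟩

/-- The reflection exchanges the segments Re u = 0 and Re u = 1/2; they are half-open at opposite
ends, so endpoints also match. -/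
theorem InRootDomain.half_sub {t : ℝ} (ht : 0 < t) {u : ℂ} (hu : InRootDomain (t * Complex.I) u)
    (h : ‖momentumRatio (t * Complex.I) u‖ = 1) :
    InRootDomain (t * Complex.I) (1 / 2 - u) := by
  have him : ((t : ℂ) * Complex.I).im = t := by simp
  have hre : (1 / 2 - u).re = 1 / 2 - u.re := by simp
  have him' : (1 / 2 - u).im = -u.im := by simp
  rw [InRootDomain, him, hre, him']
  rcases hu.re_eq ht h with ⟨h1, h2, h3⟩ | ⟨h1, h2, h3⟩
  · right
    rw [h1]
    refine ⟨?_, ?_, ?_, ?_⟩ <;> linarith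
  · left
    rw [h1]
    refine ⟨?_, ?_, ?_, ?_⟩ <;> linarith

/-- In the bilinear identity, one of the two theta factors lies on an imaginary line with integer
real part and cannot vanish. For roots on the same segment the other factor gives u ≡ v mod 2it; for
roots on different segments it would need Im u + Im v to be an odd multiple of t, which the
half-open ends exclude. -/
theorem momentumRatio_injOn {t : ℝ} (ht : 0 < t) {u v : ℂ}
    (hu : InRootDomain (t * Complex.I) u) (hv : InRootDomain (t * Complex.I) v)
    (h : ‖momentumRatio (t * Complex.I) u‖ = 1)
    (huv : momentumRatio (t * Complex.I) u = momentumRatio (t * Complex.I) v) : u = v := by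
  have hτ := im_mul_I_pos ht
  have hv1 : ‖momentumRatio (t * Complex.I) v‖ = 1 := by rw [← huv, h]
  have hne : momentumRatio (t * Complex.I) u ≠ 0 := norm_ne_zero_iff.1 (by rw [h]; exact one_ne_zero)
  have hu2 := (momentumRatio_ne_zero_iff.1 hne).2
  rw [huv] at hne
  have hv2 := (momentumRatio_ne_zero_iff.1 hne).2
  have key := theta1_mul_sub_theta1_mul_eq_zero (u := u) (v := v) hτ (by
    rw [momentumRatio, momentumRatio, div_eq_div_iff hu2 hv2] at huv
    rw [huv, mul_comm])
  have e2 : 2 * ((t : ℂ) * Complex.I) = ((2 * t : ℝ) : ℂ) * Complex.I := by push_cast; ring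
  have ht2 : 0 < 2 * t := by linarith
  have hsame (y y' : ℝ) (hy : |y - y'| < t)
      (h0 : jacobiTheta₂ (1 / 2 + ((t + y - y' : ℝ) : ℂ) * Complex.I)
        ((2 * t : ℝ) * Complex.I) = 0) : y = y' := by
    obtain ⟨m, hm⟩ := exists_int_of_jacobiTheta₂_half_add_eq_zero ht2 h0
    have h1 : y - y' = 2 * t * (m - 1) := by
      field_simp at hm
      linarith
    have h2 := abs_lt.1 hy
    have h3 : (0 : ℝ) < m := by nlinarith
    have h4 : (m : ℝ) < 2 := by nlinarith
    norm_cast at h3 h4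
    have h5 : m = 1 := by omega
    rw [h5] at h1
    push_cast at h1
    linarith
  have hdiff (y y' : ℝ) (hy : |y + y'| < t)
      (h0 : jacobiTheta₂ (1 / 2 + ((y + y' : ℝ) : ℂ) * Complex.I)
        ((2 * t : ℝ) * Complex.I) = 0) : False := by
    obtain ⟨m, hm⟩ := exists_int_of_jacobiTheta₂_half_add_eq_zero ht2 h0
    have h1 : y + y' = t * (2 * m - 1) := by
      field_simp at hm
      linarith
    have h2 := abs_lt.1 hy
    have h3 : (0 : ℝ) < m := by nlinarith
    have h4 : (m : ℝ) < 1 := by nlinarith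
    norm_cast at h3 h4
    omega
  rw [e2] at key
  have hu' := Complex.re_add_im u
  have hv' := Complex.re_add_im v
  rcases hu.re_eq ht h with ⟨a1, a2, a3⟩ | ⟨a1, a2, a3⟩ <;>
    rcases hv.re_eq ht hv1 with ⟨b1, b2, b3⟩ | ⟨b1, b2, b3⟩ <;>
    rw [a1] at hu' <;> rw [b1] at hv'
  · refine Complex.ext (by rw [a1, b1]) (key.elim (fun h0 => ?_) fun h0 => ?_)
    · refine absurd ?_ (jacobiTheta₂_imaginary_ne_zero (u.im + v.im) ht2)
      rw [← h0, ← hu', ← hv']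
      congr 1
      simp
      ring
    · refine hsame _ _ (abs_lt.2 ⟨by linarith, by linarith⟩) ?_
      rw [← h0, ← hu', ← hv']
      congr 1
      simp
      ring
  · exfalso
    refine key.elim (fun h0 => hdiff u.im v.im (abs_lt.2 ⟨by linarith, by linarith⟩) ?_) fun h0 => ?_
    · rw [← h0, ← hu', ← hv']
      congr 1
      simp
      ring
    · refine absurd ?_ (jacobiTheta₂_imaginary_ne_zero (u.im - v.im + t) ht2)
      rw [← h0, ← hu', ← hv']
      congr 1
      simp
      ring
  · exfalso
    refine key.elim (fun h0 => hdiff u.im v.im (abs_lt.2 ⟨by linarith, by linarith⟩) ?_) fun h0 => ?_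
    · rw [← h0, ← hu', ← hv']
      congr 1
      simp
      ring
    · refine absurd ?_ (jacobiTheta₂_imaginary_ne_zero (u.im - v.im + t) ht2)
      rw [← jacobiTheta₂_add_left, ← h0, ← hu', ← hv']
      congr 1
      simp
      ring
  · refine Complex.ext (by rw [a1, b1]) (key.elim (fun h0 => ?_) fun h0 => ?_)
    · refine absurd ?_ (jacobiTheta₂_imaginary_ne_zero (u.im + v.im) ht2)
      rw [← jacobiTheta₂_add_left, ← h0, ← hu', ← hv']
      congr 1
      simp
      ring
    · refine hsame _ _ (abs_lt.2 ⟨by linarith, by linarith⟩) ?_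
      rw [← h0, ← hu', ← hv']
      congr 1
      simp
      ring

/-- On both lines ū ≡ -u mod 1, and θ₃ is even with period 1. Thus numerator and denominator in the
amplitude are complex conjugates. -/
theorem conj_theta3_add_quarter {t : ℝ} {u : ℂ} (hu : u.re = 0 ∨ u.re = 1 / 2) :
    (starRingEnd ℂ) (theta3 (t * Complex.I) (u + 1 / 4)) =
      theta3 (t * Complex.I) (u - 1 / 4) := by
  rw [theta3_conj, theta3, theta3]
  have hu' := Complex.re_add_im u
  rcases hu with h | h <;> rw [h] at hu'
  · rw [← jacobiTheta₂_neg_left, ← hu']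
    congr 1
    simp only [map_add, map_mul, map_div₀, map_one, map_ofNat, Complex.conj_ofReal, Complex.conj_I]
    push_cast
    ring
  · rw [← jacobiTheta₂_neg_left, ← jacobiTheta₂_add_left, ← hu']
    congr 1
    simp only [map_add, map_mul, map_div₀, map_one, map_ofNat, Complex.conj_ofReal, Complex.conj_I]
    push_cast
    ring

theorem theta3_quarter_ne_zero {t : ℝ} (ht : 0 < t) {u : ℂ} (hu : u.re = 0 ∨ u.re = 1 / 2) :
    theta3 (t * Complex.I) (u + 1 / 4) ≠ 0 := by
  have h0 := jacobiTheta₂_quarter_mul_ne_zero u.im ht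
  have hu' := Complex.re_add_im u
  rw [theta3]
  rcases hu with h | h <;> rw [h] at hu'
  · rw [Complex.ofReal_zero, zero_add] at hu'
    rw [hu'] at h0
    exact left_ne_zero_of_mul h0
  · rw [← hu', show ((1 / 2 : ℝ) : ℂ) + u.im * Complex.I + 1 / 4 =
      u.im * Complex.I - 1 / 4 + 1 by push_cast; ring, jacobiTheta₂_add_left]
    exact right_ne_zero_of_mul h0

/-- The ratio `θ₃(u + ε_n/4) / θ₃(u - ε_n/4)`. -/
def theta3Ratio (τ : ℂ) (n : ℕ) (u : ℂ) : ℂ :=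
  theta3 τ (u + (-1) ^ n / 4) / theta3 τ (u - (-1) ^ n / 4)

theorem norm_theta3Ratio {t : ℝ} (ht : 0 < t) {u : ℂ} (hu : u.re = 0 ∨ u.re = 1 / 2) (n : ℕ) :
    ‖theta3Ratio (t * Complex.I) n u‖ = 1 := by
  have h1 : ‖theta3 (t * Complex.I) (u - 1 / 4)‖ = ‖theta3 (t * Complex.I) (u + 1 / 4)‖ := by
    rw [← conj_theta3_add_quarter hu, RCLike.norm_conj]
  have h2 := norm_ne_zero_iff.2 (theta3_quarter_ne_zero ht hu)
  rw [theta3Ratio, norm_div]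
  rcases neg_one_pow_eq_or ℂ n with h | h <;> rw [h]
  · rw [h1, div_self h2]
  · rw [neg_div, ← sub_eq_add_neg, sub_neg_eq_add, h1, div_self h2]

theorem theta3Ratio_half_sub (τ : ℂ) (n : ℕ) (u : ℂ) :
    theta3Ratio τ n (1 / 2 - u) = theta3Ratio τ n u := by
  have h1 : theta3 τ (1 / 2 - u + 1 / 4) = theta3 τ (u + 1 / 4) := by
    rw [theta3, theta3, ← jacobiTheta₂_neg_left, ← jacobiTheta₂_add_left]
    ring_nf
  have h2 : theta3 τ (1 / 2 - u - 1 / 4) = theta3 τ (u - 1 / 4) := by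
    rw [theta3, theta3, ← jacobiTheta₂_neg_left]
    ring_nf
  rw [theta3Ratio, theta3Ratio]
  rcases neg_one_pow_eq_or ℂ n with h | h <;> rw [h]
  · rw [h1, h2]
  · rw [neg_div, ← sub_eq_add_neg, ← sub_eq_add_neg, sub_neg_eq_add, sub_neg_eq_add, h1, h2]

theorem norm_cpow_half {w : ℂ} (hw : ‖w‖ = 1) : ‖w ^ (1 / 2 : ℂ)‖ = 1 := by
  have h := Complex.cpow_nat_inv_pow w two_ne_zero
  have h' := congrArg norm h
  rw [norm_pow, hw] at h'
  rw [one_div]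
  exact (pow_eq_one_iff_of_nonneg (norm_nonneg _) two_ne_zero).1 (by exact_mod_cast h')

theorem norm_eq_one_of_pow_eq {N : ℕ} [NeZero N] {k : ℕ} {z : ℂ} (h : z ^ N = (-1) ^ k) :
    ‖z‖ = 1 := by
  have h' := congrArg norm h
  rw [norm_pow, norm_pow, norm_neg, norm_one, one_pow] at h'
  exact (pow_eq_one_iff_of_nonneg (norm_nonneg _) (NeZero.ne N)).1 h'

/-- The branch of the square root plays no role beyond being a function of the theta ratio: its
modulus is 1, and equal ratios have equal roots. -/
theorem IsBetheRoots.isUnimodularAmplitude {N M : ℕ} [NeZero N] {ξ : Fin 2} {t : ℝ} (ht : 0 < t)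
    {u : Fin M → ℂ} (hu : IsBetheRoots N (t * Complex.I) ξ u) :
    IsUnimodularAmplitude N ξ (fun l => momentumRatio (t * Complex.I) (u l))
      (fun n l => theta3Ratio (t * Complex.I) n (u l) ^ (1 / 2 : ℂ))
      (fun n l => amplitude (t * Complex.I) n (u l)) := by
  have hnorm (l : Fin M) : ‖momentumRatio (t * Complex.I) (u l)‖ = 1 :=
    norm_eq_one_of_pow_eq (hu.2 l).2
  have hre (l : Fin M) : (u l).re = 0 ∨ (u l).re = 1 / 2 :=
    ((hu.2 l).1.re_eq ht (hnorm l)).imp And.left And.left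
  refine ⟨fun n l => rfl, hnorm, fun l l' h => ?_, fun l => (hu.2 l).2,
    fun n l => norm_cpow_half (norm_theta3Ratio ht (hre l) n), fun n l => ?_, fun n l l' h => ?_⟩
  · exact hu.1 (momentumRatio_injOn ht (hu.2 l).1 (hu.2 l').1 (hnorm l) h)
  · simp only [theta3Ratio, pow_add, neg_one_sq, mul_one]
  -- Because r(1/2-u) = -r(u), injectivity leaves a single root with the opposite ratio.
  · have h' : u l' = 1 / 2 - u l :=
      momentumRatio_injOn ht (hu.2 l').1 ((hu.2 l).1.half_sub ht (hnorm l)) (hnorm l')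
        (h.trans (momentumRatio_half_sub (im_mul_I_pos ht) _).symm)
    rw [h', theta3Ratio_half_sub]

theorem injOn_exp_mul_I {a p q : ℝ} (hp : p ∈ Set.Ioc a (a + 2 * Real.pi))
    (hq : q ∈ Set.Ioc a (a + 2 * Real.pi))
    (h : Complex.exp (Complex.I * p) = Complex.exp (Complex.I * q)) : p = q := by
  obtain ⟨n, hn⟩ := Complex.exp_eq_exp_iff_exists_int.1 h
  have h1 : p = q + n * (2 * Real.pi) := by
    have h2 : (p : ℂ) = q + n * (2 * Real.pi) :=
      mul_left_cancel₀ Complex.I_ne_zero (by rw [hn]; ring)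
    exact_mod_cast h2
  have h3 : n = 0 := by
    have hpi := Real.pi_pos
    have h4 : (-1 : ℝ) < n := by nlinarith [hp.1, hq.2]
    have h5 : (n : ℝ) < 1 := by nlinarith [hp.2, hq.1]
    norm_cast at h4 h5
    omega
  rw [h1, h3]
  simp

/-- The momenta differ by an odd multiple of π, which changes neither tan p nor the condition cos p
= 0. -/
theorem phi_eq_of_exp_eq_neg {Jx Jy p q : ℝ}
    (h : Complex.exp (Complex.I * q) = -Complex.exp (Complex.I * p)) :
    phi Jx Jy q = phi Jx Jy p := by
  rw [mul_comm, mul_comm Complex.I] at h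
  have hc : Real.cos q = -Real.cos p := by
    rw [← Complex.exp_ofReal_mul_I_re q, h, Complex.neg_re, Complex.exp_ofReal_mul_I_re]
  have hs : Real.sin q = -Real.sin p := by
    rw [← Complex.exp_ofReal_mul_I_im q, h, Complex.neg_im, Complex.exp_ofReal_mul_I_im]
  rw [phi, phi, Real.tan_eq_sin_div_cos, Real.tan_eq_sin_div_cos, hc, hs, neg_div_neg_eq]
  simp only [neg_eq_zero]

theorem IsQuasiMomenta.isUnimodularAmplitude {N M : ℕ} {ξ : Fin 2} {a : ℝ} {p : Fin M → ℝ}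
    (hp : IsQuasiMomenta N a ξ p) {s : ℕ → Fin M → ℂ} {A : ℕ → Fin M → ℂ}
    (hA : ∀ n l, A n l = Complex.exp (Complex.I * p l) ^ n * s n l) (hs : ∀ n l, ‖s n l‖ = 1)
    (hper : ∀ n l, s (n + 2) l = s n l)
    (hneg : ∀ n l l', Complex.exp (Complex.I * p l') = -Complex.exp (Complex.I * p l) →
      s n l' = s n l) :
    IsUnimodularAmplitude N ξ (fun l => Complex.exp (Complex.I * p l)) s A := by
  refine ⟨hA, fun l => ?_, fun l l' h => hp.1 (injOn_exp_mul_I (hp.2 l).1 (hp.2 l').1 h),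
    fun l => ?_, hs, hper, hneg⟩
  · rw [mul_comm, Complex.norm_exp_ofReal_mul_I]
  · rw [← Complex.exp_nat_mul, ← (hp.2 l).2]
    ring_nf

theorem IsQuasiMomenta.isUnimodularAmplitude_xx {N M : ℕ} {ξ : Fin 2} {a : ℝ} {p : Fin M → ℝ}
    (hp : IsQuasiMomenta N a ξ p) :
    IsUnimodularAmplitude N ξ (fun l => Complex.exp (Complex.I * p l)) (fun _ _ => 1)
      (fun n l => Complex.exp (Complex.I * ((n * p l : ℝ) : ℂ))) := by
  refine hp.isUnimodularAmplitude (fun n l => ?_) (by simp) (by simp) (by simp)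
  rw [mul_one, ← Complex.exp_nat_mul]
  push_cast
  ring_nf

theorem IsQuasiMomenta.isUnimodularAmplitude_xy {N M : ℕ} {ξ : Fin 2} {a : ℝ} {p : Fin M → ℝ}
    (hp : IsQuasiMomenta N a ξ p) (Jx Jy : ℝ) :
    IsUnimodularAmplitude N ξ (fun l => Complex.exp (Complex.I * p l))
      (fun n l => Complex.exp (((-(-1) ^ n * phi Jx Jy (p l) : ℝ) : ℂ) * Complex.I))
      (fun n l => Complex.exp
        (Complex.I * ((n * p l - (-1) ^ n * phi Jx Jy (p l) : ℝ) : ℂ))) := by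
  refine hp.isUnimodularAmplitude (fun n l => ?_)
    (fun n l => Complex.norm_exp_ofReal_mul_I _) (fun n l => ?_) fun n l l' h => ?_
  · rw [← Complex.exp_nat_mul, ← Complex.exp_add]
    push_cast
    ring_nf
  · simp only [pow_add, neg_one_sq, mul_one]
  · simp only [phi_eq_of_exp_eq_neg h]

/-! ### Minors, Cauchy–Binet and Slater determinants -/

/-- The minor of `a` with the rows in `S`, listed in increasing order; zero unless `S` has as many
elements as `a` has columns. -/
def minor {N m : ℕ} (a : Fin N → Fin m → ℂ) (S : Finset (Fin N)) : ℂ :=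
  if h : S.card = m then (Matrix.of fun j l => a (S.orderEmbOfFin h j) l).det else 0

/-- The Laplace expansion of the determinant with first row `a x` and further rows from `T`. -/
def insertMinor {N m : ℕ} (a : Fin N → Fin (m + 1) → ℂ) (x : Fin N) (T : Finset (Fin N)) : ℂ :=
  ∑ l : Fin (m + 1), (-1) ^ (l : ℕ) * a x l * minor (fun n => a n ∘ l.succAbove) T

theorem sum_orderEmbedding {N m : ℕ} {V : Type*} [AddCommMonoid V] (F : (Fin m ↪o Fin N) → V) :
    ∑ e, F e = ∑ S : Finset (Fin N),
      if h : S.card = m then F (S.orderEmbOfFin h) else 0 := by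
  refine Finset.sum_of_injOn (fun e => Finset.univ.map e.toEmbedding) ?_ (by simp) ?_ ?_
  · intro e _ e' _ h
    refine DFunLike.coe_injective ((StrictMono.range_inj e.strictMono e'.strictMono).1 ?_)
    simpa [← Finset.coe_inj] using h
  · intro S _ hS
    refine dif_neg fun h => hS ⟨S.orderEmbOfFin h, by simp, ?_⟩
    exact Finset.map_orderEmbOfFin_univ S h
  · intro e _
    have hcard : (Finset.univ.map e.toEmbedding).card = m := by simp
    rw [dif_pos hcard]
    congr 1
    exact Finset.orderEmbOfFin_unique' hcard (by simp)

theorem minor_conj {N m : ℕ} (a : Fin N → Fin m → ℂ) (S : Finset (Fin N)) :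
    (starRingEnd ℂ) (minor a S) = minor (fun n l => (starRingEnd ℂ) (a n l)) S := by
  rw [minor, minor]
  split_ifs
  · rw [RingHom.map_det]
    rfl
  · simp

/-- Cauchy–Binet. Expanding the rows by multilinearity gives a sum over maps f; non-injective ones
contribute a determinant with equal rows, and sorting writes each injective one uniquely as an
increasing map after a permutation. -/
theorem sum_minor_mul_minor_eq_det {N m : ℕ} (a b : Fin N → Fin m → ℂ) :
    ∑ S, minor a S * minor b S = (Matrix.of fun i j => ∑ n, a n i * b n j).det := by
  have hdet : (Matrix.of fun i j => ∑ n, a n i * b n j).det =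
      ∑ f : Fin m → Fin N, (∏ i, a (f i) i) * (Matrix.of fun i => b (f i)).det := by
    have h := (Matrix.detRowAlternating (n := Fin m) (R := ℂ)).toMultilinearMap.map_sum
      (fun i n => a n i • b n)
    have e : (Matrix.of fun i j => ∑ n, a n i * b n j) = fun i => ∑ n, a n i • b n := by
      ext i j
      simp [Finset.sum_apply]
    rw [e]
    refine h.trans (Finset.sum_congr rfl fun f _ => ?_)
    exact MultilinearMap.map_smul_univ _ _ _
  have hS : ∑ S, minor a S * minor b S = ∑ e : Fin m ↪o Fin N,
      (Matrix.of fun i => a (e i)).det * (Matrix.of fun i => b (e i)).det := by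
    rw [sum_orderEmbedding]
    refine Finset.sum_congr rfl fun S _ => ?_
    rw [minor, minor]
    split_ifs <;> simp
  rw [hdet, hS]
  have hexp (e : Fin m ↪o Fin N) :
      (Matrix.of fun i => a (e i)).det * (Matrix.of fun i => b (e i)).det =
      ∑ σ : Equiv.Perm (Fin m), (∏ i, a (e (σ i)) i) * (Matrix.of fun i => b (e (σ i))).det := by
    rw [Matrix.det_apply', Finset.sum_mul]
    refine Finset.sum_congr rfl fun σ _ => ?_
    have := Matrix.det_permute σ (Matrix.of fun i => b (e i))
    rw [show (Matrix.of fun i => b (e (σ i))) = (Matrix.of fun i => b (e i)).submatrix σ id from rfl,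
      this]
    simp only [Matrix.of_apply]
    ring
  simp only [hexp]
  rw [← Fintype.sum_prod_type']
  refine Finset.sum_of_injOn (fun p : (Fin m ↪o Fin N) × Equiv.Perm (Fin m) => p.1 ∘ p.2)
    ?_ (by simp) ?_ fun _ _ => rfl
  · rintro ⟨e, σ⟩ _ ⟨e', σ'⟩ _ h
    have h' : (e : Fin m → Fin N) ∘ σ = e' ∘ σ' := h
    have hr := congrArg Set.range h'
    rw [σ.surjective.range_comp, σ'.surjective.range_comp] at hr
    have he : e = e' := DFunLike.coe_injective
      ((StrictMono.range_inj e.strictMono e'.strictMono).1 hr)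
    subst he
    have hσ : σ = σ' := Equiv.ext fun i => e.injective (congrFun h' i)
    rw [hσ]
  · intro f _ hf
    have hinj : ¬ Function.Injective f := by
      intro hinj
      have hmono : StrictMono (f ∘ Tuple.sort f) :=
        (Tuple.monotone_sort f).strictMono_of_injective (hinj.comp (Tuple.sort f).injective)
      refine hf ⟨(OrderEmbedding.ofStrictMono _ hmono, (Tuple.sort f)⁻¹), by simp, ?_⟩
      ext i
      simp
    simp only [Function.Injective, not_forall] at hinj
    obtain ⟨i, j, hij, hne⟩ := hinj
    rw [Matrix.det_zero_of_row_eq hne (congrArg b hij), mul_zero]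

/-- Laplace expansion along the row x. Its rank is the number of elements of T below x, which is the
Jordan–Wigner sign of creating a fermion at x. -/
theorem minor_insert {N m : ℕ} (a : Fin N → Fin (m + 1) → ℂ) {x : Fin N} {T : Finset (Fin N)}
    (hx : x ∉ T) :
    minor a (insert x T) = (-1) ^ (T.filter (· < x)).card * insertMinor a x T := by
  by_cases hT : T.card = m
  swap
  · have h1 : (insert x T).card ≠ m + 1 := by
      rw [Finset.card_insert_of_notMem hx]
      omega
    simp [minor, insertMinor, h1, hT]
  have hcard : (insert x T).card = m + 1 := by rw [Finset.card_insert_of_notMem hx, hT]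
  obtain ⟨p, hp⟩ : ∃ p, (insert x T).orderEmbOfFin hcard p = x := by
    have : x ∈ Set.range ((insert x T).orderEmbOfFin hcard) := by simp
    exact this
  have hmem (i : Fin m) : (insert x T).orderEmbOfFin hcard (p.succAbove i) ∈ T := by
    refine (Finset.mem_insert.1 (Finset.orderEmbOfFin_mem _ hcard _)).resolve_left fun h => ?_
    exact Fin.succAbove_ne p i (((insert x T).orderEmbOfFin hcard).injective (h.trans hp.symm))
  have hemb : (insert x T).orderEmbOfFin hcard ∘ p.succAbove = T.orderEmbOfFin hT :=
    Finset.orderEmbOfFin_unique hT hmem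
      (((insert x T).orderEmbOfFin hcard).strictMono.comp (Fin.strictMono_succAbove p))
  have hpcard : (T.filter (· < x)).card = p := by
    have h1 : T.filter (· < x) =
        (Finset.Iio p).map ((insert x T).orderEmbOfFin hcard).toEmbedding := by
      ext y
      simp only [Finset.mem_filter, Finset.mem_map, Finset.mem_Iio]
      constructor
      · rintro ⟨hy, hyx⟩
        have : y ∈ Set.range ((insert x T).orderEmbOfFin hcard) := by simp [hy]
        obtain ⟨i, rfl⟩ := this
        exact ⟨i, ((insert x T).orderEmbOfFin hcard).lt_iff_lt.1 (hyx.trans_eq hp.symm), rfl⟩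
      · rintro ⟨i, hi, rfl⟩
        have hlt : (insert x T).orderEmbOfFin hcard i < x :=
          (((insert x T).orderEmbOfFin hcard).lt_iff_lt.2 hi).trans_eq hp
        exact ⟨(Finset.mem_insert.1 (Finset.orderEmbOfFin_mem _ hcard i)).resolve_left hlt.ne, hlt⟩
    rw [h1, Finset.card_map, Fin.card_Iio]
  rw [minor, dif_pos hcard, Matrix.det_succ_row _ p, hpcard, insertMinor, Finset.mul_sum]
  refine Finset.sum_congr rfl fun l _ => ?_
  rw [minor, dif_pos hT, ← hemb, Matrix.of_apply, hp, pow_add]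
  simp only [mul_assoc]
  rfl

/-- Pauli exclusion: the row x occurs twice. This allows sums over T avoiding x to be extended to
all T. -/
theorem insertMinor_of_mem {N m : ℕ} (a : Fin N → Fin (m + 1) → ℂ) {x : Fin N}
    {T : Finset (Fin N)} (hx : x ∈ T) : insertMinor a x T = 0 := by
  by_cases hT : T.card = m
  swap
  · simp [insertMinor, minor, hT]
  obtain ⟨j, hj⟩ : ∃ j, T.orderEmbOfFin hT j = x := by
    have : x ∈ Set.range (T.orderEmbOfFin hT) := by simp [hx]
    exact this
  have h : insertMinor a x T =
      (Matrix.of (Fin.cons (a x) fun j => a (T.orderEmbOfFin hT j))).det := by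
    rw [Matrix.det_succ_row_zero, insertMinor]
    refine Finset.sum_congr rfl fun l _ => ?_
    rw [minor, dif_pos hT]
    rfl
  rw [h]
  refine Matrix.det_zero_of_row_eq (Fin.succ_ne_zero j).symm ?_
  exact congrArg a hj.symm

theorem insertMinor_conj {N m : ℕ} (a : Fin N → Fin (m + 1) → ℂ) (x : Fin N)
    (S : Finset (Fin N)) :
    (starRingEnd ℂ) (insertMinor a x S) = insertMinor (fun n l => (starRingEnd ℂ) (a n l)) x S := by
  simp only [insertMinor, map_sum, map_mul, map_pow, map_neg, map_one, minor_conj]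
  rfl

/-- Orthogonality of the columns of `a`, all of squared norm `N`. -/
def OrthogonalColumns {N m : ℕ} (a : Fin N → Fin m → ℂ) : Prop :=
  ∀ l l', ∑ n, (starRingEnd ℂ) (a n l) * a n l' = if l = l' then (N : ℂ) else 0

theorem OrthogonalColumns.sum_conj_minor_mul_minor {N m : ℕ} {a : Fin N → Fin m → ℂ}
    (ha : OrthogonalColumns a) :
    ∑ S, (starRingEnd ℂ) (minor a S) * minor a S = (N : ℂ) ^ m := by
  simp only [minor_conj, sum_minor_mul_minor_eq_det]
  have h : (Matrix.of fun i j => ∑ n, (starRingEnd ℂ) (a n i) * a n j) =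
      (N : ℂ) • (1 : Matrix (Fin m) (Fin m) ℂ) := by
    ext i j
    simp [ha i j, Matrix.one_apply]
  rw [h, Matrix.det_smul]
  simp

/-- The one-particle density matrix of a Slater determinant with orthogonal orbitals. -/
theorem OrthogonalColumns.sum_conj_insertMinor_mul_insertMinor {N m : ℕ}
    {a : Fin N → Fin (m + 1) → ℂ} (ha : OrthogonalColumns a) (x y : Fin N) :
    ∑ T, (starRingEnd ℂ) (insertMinor a x T) * insertMinor a y T =
      (N : ℂ) ^ m * ∑ l, (starRingEnd ℂ) (a x l) * a y l := by
  have hdet (l l' : Fin (m + 1)) :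
      ∑ T, minor (fun n j => (starRingEnd ℂ) (a n (l.succAbove j))) T *
        minor (fun n => a n ∘ l'.succAbove) T = if l = l' then (N : ℂ) ^ m else 0 := by
    rw [sum_minor_mul_minor_eq_det]
    by_cases hl : l = l'
    · subst hl
      have h : (Matrix.of fun i j => ∑ n, (starRingEnd ℂ) (a n (l.succAbove i)) *
          (a n ∘ l.succAbove) j) = (N : ℂ) • (1 : Matrix (Fin m) (Fin m) ℂ) := by
        ext i j
        simp only [Matrix.of_apply, Function.comp_apply]
        rw [ha]
        simp [Matrix.one_apply]
      rw [h, Matrix.det_smul]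
      simp
    · rw [if_neg hl]
      -- Orbital l' survives on the conjugated side but is removed on the other, so its row in the
      -- Gram matrix is zero.
      obtain ⟨i, hi⟩ := Fin.exists_succAbove_eq (x := l') (y := l) (Ne.symm hl)
      refine Matrix.det_eq_zero_of_row_eq_zero i fun j => ?_
      simp only [Matrix.of_apply, Function.comp_apply]
      rw [ha, hi, if_neg (Fin.succAbove_ne l' j).symm]
  have hterm (T : Finset (Fin N)) :
      (starRingEnd ℂ) (insertMinor a x T) * insertMinor a y T =
      ∑ l : Fin (m + 1), ∑ l' : Fin (m + 1),
        ((-1) ^ (l : ℕ) * (starRingEnd ℂ) (a x l) * ((-1) ^ (l' : ℕ) * a y l')) *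
        (minor (fun n j => (starRingEnd ℂ) (a n (l.succAbove j))) T *
        minor (fun n => a n ∘ l'.succAbove) T) := by
    rw [insertMinor_conj, insertMinor, insertMinor, Finset.sum_mul_sum]
    refine Finset.sum_congr rfl fun l _ => Finset.sum_congr rfl fun l' _ => ?_
    rw [show (fun n => (fun l => (starRingEnd ℂ) (a n l)) ∘ l.succAbove) =
      fun n j => (starRingEnd ℂ) (a n (l.succAbove j)) from rfl]
    ring
  simp only [hterm]
  rw [Finset.sum_comm, Finset.mul_sum]
  refine Finset.sum_congr rfl fun l _ => ?_
  rw [Finset.sum_comm]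
  simp only [← Finset.mul_sum, hdet]
  simp only [mul_ite, mul_zero, Finset.sum_ite_eq, Finset.mem_univ, if_true]
  have h1 : ((-1 : ℂ) ^ (l : ℕ)) * (-1) ^ (l : ℕ) = 1 := by
    rw [← mul_pow]
    simp
  linear_combination ((starRingEnd ℂ) (a x l) * a y l * (N : ℂ) ^ m) * h1

/-! ### Product vectors -/

/-- The product vector with factors `f l`. -/
def prodVec {N : ℕ} (f : Fin N → Fin 2 → ℂ) : Config N → ℂ := fun s => ∏ l, f l (s l)

theorem siteOp_mulVec_prodVec {N : ℕ} (A : Matrix (Fin 2) (Fin 2) ℂ) (n : Fin N)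
    (f : Fin N → Fin 2 → ℂ) :
    siteOp A n *ᵥ prodVec f = prodVec (Function.update f n (A *ᵥ f n)) := by
  ext s
  have h1 (g : Fin N → ℂ) : ∏ l, g l = g n * ∏ l ∈ Finset.univ.erase n, g l :=
    (Finset.mul_prod_erase _ _ (Finset.mem_univ n)).symm
  have h2 : ∏ l, Function.update f n (A *ᵥ f n) l (s l) =
      (A *ᵥ f n) (s n) * ∏ l ∈ Finset.univ.erase n, f l (s l) := by
    rw [h1, Function.update_self]
    congr 1
    refine Finset.prod_congr rfl fun l hl => ?_
    rw [Function.update_of_ne (Finset.ne_of_mem_erase hl)]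
  rw [prodVec, h2, Matrix.mulVec, Matrix.mulVec, dotProduct, dotProduct, Finset.sum_mul]
  symm
  refine Finset.sum_of_injOn (fun x => Function.update s n x) ?_ (by simp) ?_ ?_
  · intro x _ y _ h
    simpa using congrFun h n
  · intro t _ ht
    rw [siteOp, Matrix.of_apply, if_neg, zero_mul]
    intro h
    refine ht ⟨t n, by simp, ?_⟩
    ext m
    by_cases hm : m = n
    · subst hm
      simp
    · simp [hm, h m hm]
  · intro x _
    have h3 : ∏ l ∈ Finset.univ.erase n, f l (Function.update s n x l) =
        ∏ l ∈ Finset.univ.erase n, f l (s l) := by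
      refine Finset.prod_congr rfl fun l hl => ?_
      rw [Function.update_of_ne (Finset.ne_of_mem_erase hl)]
    have h4 : ∀ m, m ≠ n → s m = Function.update s n x m := fun m hm => by simp [hm]
    rw [siteOp, Matrix.of_apply, if_pos h4, prodVec, h1, h3, Function.update_self, mul_assoc]

theorem star_prodVec_dotProduct {N : ℕ} (f g : Fin N → Fin 2 → ℂ) :
    star (prodVec f) ⬝ᵥ prodVec g = ∏ l, star (f l) ⬝ᵥ g l := by
  simp only [dotProduct, Finset.prod_univ_sum, Fintype.piFinset_univ, prodVec, Pi.star_apply,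
    star_prod, Finset.prod_mul_distrib]

theorem prodVec_update_smul {N : ℕ} (f : Fin N → Fin 2 → ℂ) (n : Fin N) (c : ℂ)
    (v : Fin 2 → ℂ) :
    prodVec (Function.update f n (c • v)) = c • prodVec (Function.update f n v) := by
  ext s
  have h1 (v : Fin 2 → ℂ) : ∏ l, Function.update f n v l (s l) =
      v (s n) * ∏ l ∈ Finset.univ.erase n, f l (s l) := by
    rw [← Finset.mul_prod_erase _ _ (Finset.mem_univ n), Function.update_self]
    congr 1
    refine Finset.prod_congr rfl fun l hl => ?_
    rw [Function.update_of_ne (Finset.ne_of_mem_erase hl)]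
  simp only [prodVec, Pi.smul_apply, smul_eq_mul, h1, mul_assoc]

/-! ### The local vectors `psi` -/

theorem I_zpow_eq_of_modEq {k k' : ℤ} (h : k ≡ k' [ZMOD 4]) : Complex.I ^ k = Complex.I ^ k' := by
  obtain ⟨c, hc⟩ := h.dvd
  have : k' = k + 4 * c := by omega
  rw [this, zpow_add₀ Complex.I_ne_zero, zpow_mul]
  have h4 : Complex.I ^ (4 : ℤ) = 1 := by exact_mod_cast Complex.I_pow_four
  rw [h4, one_zpow, mul_one]

theorem psi_eq_of_modEq {k k' : ℤ} (h : k ≡ k' [ZMOD 4]) : psi k = psi k' := by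
  rw [psi, psi, I_zpow_eq_of_modEq h]

theorem I_zpow_two : Complex.I ^ (2 : ℤ) = -1 := by exact_mod_cast Complex.I_sq

theorem sigmaX_mulVec_psi (k : ℤ) :
    (!![0, 1; 1, 0] : Matrix (Fin 2) (Fin 2) ℂ) *ᵥ psi k = Complex.I ^ k • psi (-k) := by
  have h := zpow_ne_zero k Complex.I_ne_zero
  ext i
  fin_cases i
  · simp [psi, Matrix.mulVec, dotProduct, div_eq_mul_inv]
  · simp [psi, Matrix.mulVec, dotProduct, zpow_neg]
    field_simp

theorem sigmaY_mulVec_psi (k : ℤ) :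
    (!![0, -Complex.I; Complex.I, 0] : Matrix (Fin 2) (Fin 2) ℂ) *ᵥ psi k =
      Complex.I ^ (k - 1) • psi (2 - k) := by
  have h := zpow_ne_zero k Complex.I_ne_zero
  ext i
  fin_cases i
  · simp [psi, Matrix.mulVec, dotProduct, div_eq_mul_inv, zpow_sub₀ Complex.I_ne_zero]
    ring
  · simp [psi, Matrix.mulVec, dotProduct, zpow_sub₀ Complex.I_ne_zero]
    field_simp

theorem star_psi_dotProduct_psi_of_modEq {k k' : ℤ} (h : k ≡ k' [ZMOD 4]) :
    star (psi k) ⬝ᵥ psi k' = 1 := by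
  rw [psi_eq_of_modEq h]
  have h2 : (Real.sqrt 2 : ℂ) * Real.sqrt 2 = 2 := by
    rw [← Complex.ofReal_mul, Real.mul_self_sqrt (by norm_num)]
    norm_num
  have h3 : (Real.sqrt 2 : ℂ) ≠ 0 := left_ne_zero_of_mul (h2 ▸ two_ne_zero)
  have h4 := zpow_ne_zero k' Complex.I_ne_zero
  have h5 : (-Complex.I) ^ k' * Complex.I ^ k' = 1 := by
    rw [← mul_zpow]
    simp
  simp [psi, dotProduct]
  field_simp
  linear_combination h5 - h2

theorem star_psi_dotProduct_psi_of_modEq_add_two {k k' : ℤ} (h : k ≡ k' + 2 [ZMOD 4]) :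
    star (psi k) ⬝ᵥ psi k' = 0 := by
  rw [psi_eq_of_modEq h]
  have h5 : (-Complex.I) ^ k' * Complex.I ^ k' = 1 := by
    rw [← mul_zpow]
    simp
  have h6 : (-Complex.I) ^ (k' + 2) = -(-Complex.I) ^ k' := by
    rw [zpow_add₀ (neg_ne_zero.2 Complex.I_ne_zero)]
    have : (-Complex.I) ^ (2 : ℤ) = -1 := by
      rw [← I_zpow_two]
      exact even_two.neg_zpow _
    rw [this, mul_neg_one]
  simp [psi, dotProduct, h6]
  linear_combination -((Real.sqrt 2 : ℂ)⁻¹ * (Real.sqrt 2 : ℂ)⁻¹) * h5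

/-! ### Action of the two-site operators -/

theorem sigmaX_mul_sigmaY_mulVec {N : ℕ} (K : Fin N → ℤ) {n n' : Fin N} (h : n ≠ n') :
    (sigmaX n * sigmaY n') *ᵥ prodVec (psi ∘ K) = (Complex.I ^ K n * Complex.I ^ (K n' - 1)) •
      prodVec (psi ∘ Function.update (Function.update K n' (2 - K n')) n (-K n)) := by
  rw [← Matrix.mulVec_mulVec, sigmaX, sigmaY, siteOp_mulVec_prodVec, Function.comp_apply,
    sigmaY_mulVec_psi, prodVec_update_smul, Matrix.mulVec_smul, siteOp_mulVec_prodVec,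
    Function.update_of_ne h, Function.comp_apply, sigmaX_mulVec_psi, prodVec_update_smul, smul_smul,
    mul_comm, Function.comp_update, Function.comp_update]

theorem sigmaY_mul_sigmaX_mulVec {N : ℕ} (K : Fin N → ℤ) {n n' : Fin N} (h : n ≠ n') :
    (sigmaY n * sigmaX n') *ᵥ prodVec (psi ∘ K) = (Complex.I ^ (K n - 1) * Complex.I ^ K n') •
      prodVec (psi ∘ Function.update (Function.update K n' (-K n')) n (2 - K n)) := by
  rw [← Matrix.mulVec_mulVec, sigmaX, sigmaY, siteOp_mulVec_prodVec, Function.comp_apply,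
    sigmaX_mulVec_psi, prodVec_update_smul, Matrix.mulVec_smul, siteOp_mulVec_prodVec,
    Function.update_of_ne h, Function.comp_apply, sigmaY_mulVec_psi, prodVec_update_smul, smul_smul,
    mul_comm, Function.comp_update, Function.comp_update]

theorem prodVec_psi_eq_of_modEq {N : ℕ} {K K' : Fin N → ℤ} (h : ∀ l, K l ≡ K' l [ZMOD 4]) :
    prodVec (psi ∘ K) = prodVec (psi ∘ K') := by
  congr 1
  funext l
  exact psi_eq_of_modEq (h l)

/-- The phases after flipping the spins at the sites `n` and `n'`. -/
def flipPhase {N : ℕ} (K : Fin N → ℤ) (n n' : Fin N) (l : Fin N) : ℤ :=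
  K l + if l = n ∨ l = n' then 2 else 0

/-- The sign `1 - 2 b` attached to the presence of a kink. -/
def kinkSign (p : Prop) [Decidable p] : ℂ := if p then -1 else 1

theorem I_zpow_mul_I_zpow {k k' j : ℤ} (p : Prop) [Decidable p]
    (h : k + k' ≡ (if p then 2 else 0) + 2 * j [ZMOD 4]) :
    Complex.I ^ k * Complex.I ^ k' = kinkSign p * (-1) ^ j := by
  rw [← zpow_add₀ Complex.I_ne_zero, I_zpow_eq_of_modEq h, zpow_add₀ Complex.I_ne_zero, zpow_mul,
    I_zpow_two, kinkSign]
  split_ifs <;> simp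

/-- Modulo 4, k ↦ -k fixes even k and k ↦ 2-k fixes odd k. At the first site the phase 1-κ is even
for both κ, which makes σ^x₁σ^y₂ diagonal. -/
theorem sigmaX_mul_sigmaY_mulVec_of_even {N : ℕ} {K : Fin N → ℤ} {n n' : Fin N} (hne : n ≠ n')
    (p : Prop) [Decidable p] (hp : K n' ≡ K n + 1 - (if p then 2 else 0) [ZMOD 4])
    (hK : Even (K n)) :
    (sigmaX n * sigmaY n') *ᵥ prodVec (psi ∘ K) = kinkSign p • prodVec (psi ∘ K) := by
  obtain ⟨a, ha⟩ := hK
  have e1 := I_zpow_mul_I_zpow (k := K n) (k' := K n' - 1) (j := 0) p (by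
    unfold Int.ModEq at hp ⊢
    split_ifs at hp ⊢ <;> omega)
  rw [sigmaX_mul_sigmaY_mulVec K hne, e1, zpow_zero, mul_one]
  congr 1
  refine prodVec_psi_eq_of_modEq fun l => ?_
  unfold Int.ModEq at hp ⊢
  simp only [Function.update_apply]
  split_ifs at hp ⊢ <;> subst_vars <;> omega

/-- Neighbouring phases have opposite parity. By the parity rules for k ↦ -k and k ↦ 2-k, one of the
two products fixes both factors and the other shifts both phases by 2; the parity of `K n` decides
which. -/
theorem currentOp_mulVec_prodVec {N : ℕ} [NeZero N] {K : Fin N → ℤ} {n : Fin N} (hne : n ≠ n + 1)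
    (p : Prop) [Decidable p] (hp : K (n + 1) ≡ K n + 1 - (if p then 2 else 0) [ZMOD 4]) :
    currentOp n *ᵥ prodVec (psi ∘ K) =
      kinkSign p • (prodVec (psi ∘ K) - prodVec (psi ∘ flipPhase K n (n + 1))) := by
  rw [currentOp, Matrix.sub_mulVec, sigmaX_mul_sigmaY_mulVec K hne, sigmaY_mul_sigmaX_mulVec K hne,
    smul_sub]
  rcases Int.even_or_odd' (K n) with ⟨a, ha | ha⟩
  · have e1 := I_zpow_mul_I_zpow (k := K n) (k' := K (n + 1) - 1) (j := 0) p (by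
      unfold Int.ModEq at hp ⊢
      split_ifs at hp ⊢ <;> omega)
    have e2 := I_zpow_mul_I_zpow (k := K n - 1) (k' := K (n + 1)) (j := 0) p (by
      unfold Int.ModEq at hp ⊢
      split_ifs at hp ⊢ <;> omega)
    rw [e1, e2, zpow_zero, mul_one]
    congr 2 <;> refine prodVec_psi_eq_of_modEq fun l => ?_ <;> unfold Int.ModEq at hp ⊢ <;>
      simp only [Function.update_apply, flipPhase] <;>
      split_ifs at hp ⊢ <;> subst_vars <;> omega
  · have e1 := I_zpow_mul_I_zpow (k := K n) (k' := K (n + 1) - 1) (j := 1) p (by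
      unfold Int.ModEq at hp ⊢
      split_ifs at hp ⊢ <;> omega)
    have e2 := I_zpow_mul_I_zpow (k := K n - 1) (k' := K (n + 1)) (j := 1) p (by
      unfold Int.ModEq at hp ⊢
      split_ifs at hp ⊢ <;> omega)
    rw [e1, e2, zpow_one, mul_neg_one, neg_smul, neg_smul, sub_neg_eq_add, neg_add_eq_sub]
    congr 2 <;> refine prodVec_psi_eq_of_modEq fun l => ?_ <;> unfold Int.ModEq at hp ⊢ <;>
      simp only [Function.update_apply, flipPhase] <;>
      split_ifs at hp ⊢ <;> subst_vars <;> omega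

/-! ### Kinks -/

/-- The number of kinks at positions less than `i`. -/
def kinkCount {N : ℕ} (S : Finset (Fin N)) (i : ℕ) : ℕ := (S.filter fun x : Fin N => (x : ℕ) < i).card

theorem kinkCount_zero {N : ℕ} (S : Finset (Fin N)) : kinkCount S 0 = 0 := by simp [kinkCount]

theorem kinkCount_self {N : ℕ} (S : Finset (Fin N)) : kinkCount S N = S.card := by
  simp [kinkCount]

theorem kinkCount_succ {N : ℕ} (S : Finset (Fin N)) (l : Fin N) :
    kinkCount S (l + 1) = kinkCount S l + if l ∈ S then 1 else 0 := by
  have h : (S.filter fun x : Fin N => (x : ℕ) < l + 1) =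
      (S.filter fun x : Fin N => (x : ℕ) < l) ∪ S.filter fun x => x = l := by
    ext x
    simp only [Finset.mem_filter, Finset.mem_union, ← and_or_left, Fin.ext_iff]
    refine and_congr_right fun _ => ?_
    omega
  rw [kinkCount, h, Finset.card_union_of_disjoint]
  · rw [kinkCount]
    congr 1
    rw [Finset.filter_eq']
    split_ifs <;> rfl
  · rw [Finset.disjoint_filter]
    rintro x _ hx rfl
    exact lt_irrefl _ hx

/-- The exponent of the factor of `|κ; S⟩` at the site `l`. -/
def kinkPhase {N : ℕ} (κ : ℤˣ) (S : Finset (Fin N)) (l : Fin N) : ℤ :=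
  ((l : ℕ) : ℤ) + 1 - 2 * kinkCount S l - (κ : ℤ)

/-- The product vector with kinks at `S`, without its phase prefactor. -/
def kinkVec {N : ℕ} (κ : ℤˣ) (S : Finset (Fin N)) : Config N → ℂ := prodVec (psi ∘ kinkPhase κ S)

theorem val_add_one_eq {N : ℕ} [NeZero N] (hN : 2 ≤ N) (l : Fin N) :
    ((l + 1 : Fin N) : ℕ) = if (l : ℕ) + 1 = N then 0 else (l : ℕ) + 1 := by
  have h1 : ((1 : Fin N) : ℕ) = 1 := by
    rw [Fin.val_one']
    exact Nat.mod_eq_of_lt hN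
  have hl := l.isLt
  rw [Fin.val_add, h1]
  split_ifs with h
  · rw [h, Nat.mod_self]
  · exact Nat.mod_eq_of_lt (by omega)

/-- Each step adds 1 and each kink subtracts 2. Across the seam the total N - 2|S| must vanish
modulo 4. -/
theorem kinkPhase_add_one {N : ℕ} [NeZero N] (hN : 2 ≤ N) (κ : ℤˣ) {S : Finset (Fin N)}
    (hS : (4 : ℤ) ∣ N - 2 * S.card) (l : Fin N) :
    kinkPhase κ S (l + 1) ≡ kinkPhase κ S l + 1 - (if l ∈ S then 2 else 0) [ZMOD 4] := by
  have h := kinkCount_succ S l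
  have hNc := kinkCount_self S
  unfold Int.ModEq
  rw [kinkPhase, kinkPhase, val_add_one_eq hN]
  by_cases hl : (l : ℕ) + 1 = N
  · rw [if_pos hl, kinkCount_zero]
    rw [hl, hNc] at h
    split_ifs at h ⊢ <;> omega
  · rw [if_neg hl, h]
    split_ifs at h ⊢ <;> push_cast <;> omega

theorem kinkPhase_zero {N : ℕ} [NeZero N] (κ : ℤˣ) (S : Finset (Fin N)) :
    kinkPhase κ S 0 = 1 - κ := by
  simp [kinkPhase, kinkCount_zero]

/-- A sequence of phases is determined modulo `4` by its first term and its kinks. -/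
theorem prodVec_psi_eq_kinkVec {N : ℕ} [NeZero N] (hN : 2 ≤ N) {κ : ℤˣ} {S : Finset (Fin N)}
    {K : Fin N → ℤ} (h0 : K 0 ≡ 1 - κ [ZMOD 4])
    (h : ∀ l, K (l + 1) ≡ K l + 1 - (if l ∈ S then 2 else 0) [ZMOD 4]) :
    prodVec (psi ∘ K) = kinkVec κ S := by
  refine prodVec_psi_eq_of_modEq fun l => ?_
  obtain ⟨i, hi⟩ := l
  induction i with
  | zero =>
    have : (⟨0, hi⟩ : Fin N) = 0 := by ext; simp
    rw [this, kinkPhase_zero]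
    exact h0
  | succ i ih =>
    have hi' : i < N := by omega
    have e : (⟨i, hi'⟩ : Fin N) + 1 = ⟨i + 1, hi⟩ := by
      ext
      rw [val_add_one_eq hN]
      simp only
      rw [if_neg (by omega)]
    have h1 := h ⟨i, hi'⟩
    have h2 := kinkCount_succ S ⟨i, hi'⟩
    have h3 := ih hi'
    rw [e] at h1
    simp only at h2
    unfold Int.ModEq at *
    simp only [kinkPhase] at *
    split_ifs at h1 h2 <;> push_cast at * <;> omega

/-- As κ is odd, the parity of the phase depends on the site alone. Hence at every site two basis
vectors have equal or orthogonal factors. -/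
theorem kinkPhase_modEq_two {N : ℕ} (κ κ' : ℤˣ) (S S' : Finset (Fin N)) (l : Fin N) :
    kinkPhase κ S l ≡ kinkPhase κ' S' l [ZMOD 4] ∨
      kinkPhase κ S l ≡ kinkPhase κ' S' l + 2 [ZMOD 4] := by
  unfold Int.ModEq kinkPhase
  rcases Int.units_eq_one_or κ with rfl | rfl <;> rcases Int.units_eq_one_or κ' with rfl | rfl <;>
    push_cast <;> omega

/-- A nonzero overlap forces all phases to agree modulo 4; the first phase then determines κ and the
increments determine the kinks. -/
theorem star_kinkVec_dotProduct_kinkVec {N : ℕ} [NeZero N] (hN : 2 ≤ N) {κ κ' : ℤˣ}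
    {S S' : Finset (Fin N)} (hS : (4 : ℤ) ∣ N - 2 * S.card) (hS' : (4 : ℤ) ∣ N - 2 * S'.card) :
    star (kinkVec κ S) ⬝ᵥ kinkVec κ' S' = if (κ, S) = (κ', S') then 1 else 0 := by
  rw [kinkVec, kinkVec, star_prodVec_dotProduct]
  split_ifs with h
  · obtain ⟨rfl, rfl⟩ := Prod.mk.inj h
    exact Finset.prod_eq_one fun l _ => star_psi_dotProduct_psi_of_modEq rfl
  · by_contra hne
    refine h ?_
    have hall (l : Fin N) : kinkPhase κ S l ≡ kinkPhase κ' S' l [ZMOD 4] := by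
      refine (kinkPhase_modEq_two κ κ' S S' l).resolve_right fun h2 => hne ?_
      exact Finset.prod_eq_zero (Finset.mem_univ l) (star_psi_dotProduct_psi_of_modEq_add_two h2)
    have hκ : κ = κ' := by
      have h0 := hall 0
      rw [kinkPhase_zero, kinkPhase_zero] at h0
      rcases Int.units_eq_one_or κ with rfl | rfl <;>
        rcases Int.units_eq_one_or κ' with rfl | rfl <;> first | rfl | (exfalso; revert h0; decide)
    have hSS : S = S' := by
      ext l
      have h1 := hall l
      have h2 := hall (l + 1)
      have h3 := kinkPhase_add_one hN κ hS l
      have h4 := kinkPhase_add_one hN κ' hS' l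
      unfold Int.ModEq at *
      by_cases hl : l ∈ S <;> by_cases hl' : l ∈ S' <;>
        simp only [hl, hl', if_true, if_false] at * <;> omega
    rw [hκ, hSS]

/-- The sign of `κ` changes when the flipped sites `n`, `n + 1` include the first site. -/
def flipSign {N : ℕ} (n : Fin N) : ℤˣ := if (n : ℕ) = 0 ∨ (n : ℕ) + 1 = N then -1 else 1

theorem sub_one_ne_add_one {N : ℕ} [NeZero N] (hN : 4 ≤ N) (n : Fin N) : n - 1 ≠ n + 1 := by
  intro h
  have h1 : n = n + 1 + 1 := by rw [← h, sub_add_cancel]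
  have h2 := congrArg Fin.val h1
  rw [val_add_one_eq (by omega), val_add_one_eq (by omega)] at h2
  split_ifs at h2 <;> omega

theorem ne_add_one {N : ℕ} [NeZero N] (hN : 2 ≤ N) (n : Fin N) : n ≠ n + 1 := by
  intro h
  have h2 := congrArg Fin.val h
  rw [val_add_one_eq hN] at h2
  split_ifs at h2 <;> omega

/-- Adding 2 at n and n+1 leaves the increment between them alone and alters those leaving n-1 and
n+1, toggling these two kinks. If the first site is among the shifted ones, its phase 1-κ becomes
1+κ modulo 4. -/
theorem currentOp_mulVec_kinkVec {N : ℕ} [NeZero N] (hN : 4 ≤ N) (κ : ℤˣ) {S : Finset (Fin N)}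
    (hS : (4 : ℤ) ∣ N - 2 * S.card) (n : Fin N) :
    currentOp n *ᵥ kinkVec κ S = kinkSign (n ∈ S) •
      (kinkVec κ S - kinkVec (κ * flipSign n) (symmDiff S {n - 1, n + 1})) := by
  have hN2 : 2 ≤ N := by omega
  rw [kinkVec, currentOp_mulVec_prodVec (ne_add_one hN2 n) _ (kinkPhase_add_one hN2 κ hS n)]
  congr 2
  refine prodVec_psi_eq_kinkVec hN2 ?_ fun l => ?_
  · have h0 : (0 : Fin N) = n ↔ (n : ℕ) = 0 := by
      rw [Fin.ext_iff, Fin.val_zero, eq_comm]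
    have h1 : (0 : Fin N) = n + 1 ↔ (n : ℕ) + 1 = N := by
      rw [Fin.ext_iff, Fin.val_zero, val_add_one_eq hN2]
      by_cases h : (n : ℕ) + 1 = N <;> simp [h]
    rw [flipPhase, kinkPhase_zero, flipSign]
    simp only [h0, h1]
    unfold Int.ModEq
    rcases Int.units_eq_one_or κ with rfl | rfl <;> split_ifs <;> decide
  · have hl := kinkPhase_add_one hN2 κ hS l
    have h1 : l + 1 = n ↔ l = n - 1 := eq_sub_iff_add_eq.symm
    have h2 : l + 1 = n + 1 ↔ l = n := add_left_inj 1
    have h3 := ne_add_one hN2 n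
    have h4 : n - 1 ≠ n := fun h => ne_add_one hN2 n (sub_eq_iff_eq_add.1 h)
    have h5 := sub_one_ne_add_one hN n
    simp only [flipPhase, h1, h2, Finset.mem_symmDiff, Finset.mem_insert, Finset.mem_singleton]
    unfold Int.ModEq at *
    rcases Classical.propComplete (l ∈ S) with c0 | c0 <;>
      rcases Classical.propComplete (l = n - 1) with c1 | c1 <;>
      rcases Classical.propComplete (l = n) with c2 | c2 <;>
      rcases Classical.propComplete (l = n + 1) with c3 | c3 <;>
      first
        | exact absurd ((of_eq_true c2).symm.trans (of_eq_true c3)) h3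
        | exact absurd ((of_eq_true c1).symm.trans (of_eq_true c2)) h4
        | exact absurd ((of_eq_true c1).symm.trans (of_eq_true c3)) h5
        | (simp only [c0, c1, c2, c3, if_true, if_false, or_true, or_false,
            not_true, not_false_iff, and_true, and_false] at hl ⊢
           omega)

/-! ### Expectation values in expansions over orthonormal vectors -/

/-- The predicate `P` marks the indices on which the family is orthonormal: in the application, kink
numbers compatible with the periodic closure. -/
theorem star_sum_dotProduct {ι : Type*} [Fintype ι] [DecidableEq ι] {N : ℕ} {V : ι → Config N → ℂ}
    {c : ι → ℂ} {P : ι → Prop} (hc : ∀ i, c i ≠ 0 → P i)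
    (hV : ∀ i j, P i → P j → star (V i) ⬝ᵥ V j = if i = j then 1 else 0) {j : ι} (hj : P j) :
    star (∑ i, c i • V i) ⬝ᵥ V j = (starRingEnd ℂ) (c j) := by
  rw [star_sum, sum_dotProduct, Finset.sum_eq_single j]
  · rw [star_smul, smul_dotProduct, hV j j hj hj, if_pos rfl]
    simp
  · intro i _ hij
    rw [star_smul, smul_dotProduct]
    by_cases hi : c i = 0
    · simp [hi]
    · rw [hV i j (hc i hi) hj, if_neg hij, smul_zero]
  · simp

theorem expect_sum {ι : Type*} [Fintype ι] {N : ℕ} (V : ι → Config N → ℂ)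
    (c : ι → ℂ) (A : Matrix (Config N) (Config N) ℂ) :
    expect (∑ i, c i • V i) A = ∑ i, c i * (star (∑ i, c i • V i) ⬝ᵥ (A *ᵥ V i)) := by
  rw [expect, Matrix.mulVec_sum, dotProduct_sum]
  simp only [Matrix.mulVec_smul, dotProduct_smul, smul_eq_mul]

/-! ### Expansion of the chiral states -/

/-- The phase `(-i)^{∑ (n_j)}` of the chiral basis vectors. -/
def kinkPrefactor {N : ℕ} (S : Finset (Fin N)) : ℂ := (-Complex.I) ^ (∑ x ∈ S, ((x : ℕ) + 1))

theorem kinkPrefactor_insert {N : ℕ} {S : Finset (Fin N)} {x : Fin N} (hx : x ∉ S) :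
    kinkPrefactor (insert x S) = (-Complex.I) ^ ((x : ℕ) + 1) * kinkPrefactor S := by
  rw [kinkPrefactor, Finset.sum_insert hx, pow_add, kinkPrefactor]

theorem conj_kinkPrefactor_mul_self {N : ℕ} (S : Finset (Fin N)) :
    (starRingEnd ℂ) (kinkPrefactor S) * kinkPrefactor S = 1 := by
  rw [kinkPrefactor, map_pow, ← mul_pow]
  simp

theorem chiralVec_eq {N M : ℕ} (κ : ℤˣ) (e : Fin M ↪o Fin N) :
    chiralVec κ e = kinkPrefactor (Finset.univ.map e.toEmbedding) •
      kinkVec κ (Finset.univ.map e.toEmbedding) := by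
  ext s
  rw [chiralVec, kinkPrefactor, Finset.sum_map, Pi.smul_apply, smul_eq_mul]
  congr 1
  refine Finset.prod_congr rfl fun l _ => ?_
  have h : kinkCount (Finset.univ.map e.toEmbedding) l =
      (Finset.univ.filter fun j => e j < l).card := by
    rw [kinkCount, Finset.filter_map, Finset.card_map]
    rfl
  rw [Function.comp_apply, kinkPhase, h]

/-- The coefficients of a chiral state with respect to the vectors `kinkVec`. -/
def kinkCoeff {N M : ℕ} (ξ : Fin 2) (a : Fin N → Fin M → ℂ) (i : ℤˣ × Finset (Fin N)) : ℂ :=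
  (1 / (Real.sqrt (2 * (N : ℝ) ^ M) : ℂ)) * minor a i.2 * (((i.1 : ℤ) : ℂ) ^ (ξ : ℕ)) *
    kinkPrefactor i.2

/-- The sum can run over all subsets, since `minor` is zero by default on those of the wrong size.
-/
theorem chiralState_eq (N : ℕ) {M : ℕ} (ξ : Fin 2) (A : ℕ → Fin M → ℂ) :
    chiralState N ξ A = ∑ i : ℤˣ × Finset (Fin N),
      kinkCoeff ξ (fun n : Fin N => A ((n : ℕ) + 1)) i • kinkVec i.1 i.2 := by
  rw [chiralState, sum_orderEmbedding, Fintype.sum_prod_type, Finset.sum_comm]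
  refine Finset.sum_congr rfl fun S _ => ?_
  by_cases h : S.card = M
  · rw [dif_pos h]
    refine Finset.sum_congr rfl fun κ _ => ?_
    rw [chiralVec_eq, kinkCoeff, minor, dif_pos h, Finset.map_orderEmbOfFin_univ, smul_smul]
  · rw [dif_neg h]
    symm
    refine Finset.sum_eq_zero fun κ _ => ?_
    simp [kinkCoeff, minor, h]

theorem Admissible.dvd {N M : ℕ} (h : Admissible N M) : (4 : ℤ) ∣ N - 2 * M := by
  obtain ⟨⟨k, hk⟩, -, h3⟩ := h
  unfold Nat.ModEq at h3
  omega

theorem card_eq_of_minor_ne_zero {N m : ℕ} {a : Fin N → Fin m → ℂ} {S : Finset (Fin N)}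
    (h : minor a S ≠ 0) : S.card = m := by
  by_contra hS
  exact h (dif_neg hS)

/-! ### Sums over kink positions -/

theorem sum_mem_eq_sum_insert {N : ℕ} (n : Fin N) (F : Finset (Fin N) → ℂ) :
    (∑ S, if n ∈ S then F S else 0) = ∑ T, if n ∉ T then F (insert n T) else 0 := by
  rw [← Finset.sum_filter, ← Finset.sum_filter]
  refine Finset.sum_nbij' (fun S => S.erase n) (fun T => insert n T) ?_ ?_ ?_ ?_ ?_
  · intro S _
    simp
  · intro T _
    simp
  · intro S hS
    exact Finset.insert_erase (Finset.mem_filter.1 hS).2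
  · intro T hT
    exact Finset.erase_insert (Finset.mem_filter.1 hT).2
  · intro S hS
    rw [Finset.insert_erase (Finset.mem_filter.1 hS).2]

theorem sum_eq_sum_insert_add_insert {N : ℕ} {x y : Fin N} (hxy : x ≠ y)
    {F : Finset (Fin N) → ℂ} (hF : ∀ S, (x ∈ S ↔ y ∈ S) → F S = 0) :
    ∑ S, F S = ∑ T, if x ∉ T ∧ y ∉ T then F (insert x T) + F (insert y T) else 0 := by
  have h1 (S : Finset (Fin N)) : F S =
      (if x ∈ S then (if y ∈ S then 0 else F S) else 0) +
        if y ∈ S then (if x ∈ S then 0 else F S) else 0 := by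
    by_cases hx : x ∈ S <;> by_cases hy : y ∈ S <;> simp [hx, hy, hF S]
  rw [Finset.sum_congr rfl fun S _ => h1 S, Finset.sum_add_distrib, sum_mem_eq_sum_insert,
    sum_mem_eq_sum_insert, ← Finset.sum_add_distrib]
  refine Finset.sum_congr rfl fun T _ => ?_
  by_cases hx : x ∈ T <;> by_cases hy : y ∈ T <;> simp [hx, hy, hxy, hxy.symm]

theorem conj_insertMinor_mul_of_notMem {N m : ℕ} {a : Fin N → Fin (m + 1) → ℂ} {x : Fin N}
    {T : Finset (Fin N)} (hx : x ∉ T) :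
    (starRingEnd ℂ) (minor a (insert x T)) * minor a (insert x T) =
      (starRingEnd ℂ) (insertMinor a x T) * insertMinor a x T := by
  rw [minor_insert a hx, map_mul, map_pow, map_neg, map_one]
  have h : ((-1 : ℂ) ^ (T.filter (· < x)).card) * (-1) ^ (T.filter (· < x)).card = 1 := by
    rw [← mul_pow]
    simp
  linear_combination ((starRingEnd ℂ) (insertMinor a x T) * insertMinor a x T) * h

/-- The expectation value of `1 - 2 n_x` in a Slater determinant. -/
theorem OrthogonalColumns.sum_kinkSign_mul {N m : ℕ} {a : Fin N → Fin m → ℂ}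
    (ha : OrthogonalColumns a) (x : Fin N) :
    (N : ℂ) * ∑ S, kinkSign (x ∈ S) * ((starRingEnd ℂ) (minor a S) * minor a S) =
      (N : ℂ) ^ m * (N - 2 * ∑ l, (starRingEnd ℂ) (a x l) * a x l) := by
  have h1 (S : Finset (Fin N)) : kinkSign (x ∈ S) * ((starRingEnd ℂ) (minor a S) * minor a S) =
      (starRingEnd ℂ) (minor a S) * minor a S -
        2 * if x ∈ S then (starRingEnd ℂ) (minor a S) * minor a S else 0 := by
    rw [kinkSign]
    split_ifs <;> ring
  rw [Finset.sum_congr rfl fun S _ => h1 S, Finset.sum_sub_distrib, ← Finset.mul_sum,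
    ha.sum_conj_minor_mul_minor, sum_mem_eq_sum_insert]
  -- Without kinks there is no orbital to expand along, and the occupation term is zero.
  cases m with
  | zero =>
    have h2 (T : Finset (Fin N)) : (if x ∉ T then
        (starRingEnd ℂ) (minor a (insert x T)) * minor a (insert x T) else 0) = 0 := by
      rw [minor, dif_neg (by simp)]
      simp
    simp [h2]
  | succ m =>
    have h2 (T : Finset (Fin N)) : (if x ∉ T then
        (starRingEnd ℂ) (minor a (insert x T)) * minor a (insert x T) else 0) =
        (starRingEnd ℂ) (insertMinor a x T) * insertMinor a x T := by
      split_ifs with h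
      · rw [insertMinor_of_mem a h, mul_zero]
      · exact conj_insertMinor_mul_of_notMem h
    simp only [h2, ha.sum_conj_insertMinor_mul_insertMinor]
    ring

theorem card_filter_lt {N : ℕ} (T : Finset (Fin N)) (x : Fin N) :
    (T.filter (· < x)).card = kinkCount T x := rfl

/-- The fermionic sign of a hop over the site `n`, combined with the phases of the basis. -/
theorem hop_sign {N m : ℕ} [NeZero N] (hN : 4 ≤ N) (hM : (4 : ℤ) ∣ N - 2 * (m + 1 : ℕ))
    {T : Finset (Fin N)} (hT : T.card = m) {n : Fin N} (hx : n - 1 ∉ T) :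
    kinkSign (n ∈ T) * ((-1) ^ kinkCount T (n - 1 : Fin N) * (-1) ^ kinkCount T (n + 1 : Fin N)) *
      ((starRingEnd ℂ) ((-Complex.I) ^ (((n - 1 : Fin N) : ℕ) + 1)) *
        (-Complex.I) ^ (((n + 1 : Fin N) : ℕ) + 1)) = -(((flipSign n : ℤˣ) : ℤ) : ℂ) := by
  have hx1 := val_add_one_eq (by omega) (n - 1)
  have hy1 := val_add_one_eq (by omega) n
  have cx := kinkCount_succ T (n - 1)
  have cn := kinkCount_succ T n
  have cN := kinkCount_self T
  have c0 := kinkCount_zero T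
  rw [sub_add_cancel] at hx1
  rw [if_neg hx, add_zero] at cx
  rw [hT] at cN
  -- This is where admissibility enters: i^N = (-1)^M balances, in hops across the seam, the
  -- fermionic sign of passing the other m kinks.
  have hIN : Complex.I ^ N = (-1) ^ (m + 1) := by
    have h1 : (N : ℤ) ≡ 2 * (m + 1 : ℕ) [ZMOD 4] := by
      unfold Int.ModEq
      omega
    have h2 := I_zpow_eq_of_modEq h1
    rw [zpow_mul, I_zpow_two] at h2
    exact_mod_cast h2
  have hsq (k : ℕ) : ((-1 : ℂ) ^ k) * (-1) ^ k = 1 := by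
    rw [← mul_pow]
    simp
  have hII (k : ℕ) : Complex.I ^ k * (-Complex.I) ^ k = 1 := by
    rw [← mul_pow]
    simp
  rw [map_pow, map_neg, Complex.conj_I, neg_neg]
  have hxlt := (n - 1).isLt
  have hylt := (n + 1).isLt
  by_cases h0 : (n : ℕ) = 0
  · have ex : ((n - 1 : Fin N) : ℕ) + 1 = N := by
      split_ifs at hx1 <;> omega
    have ey : ((n + 1 : Fin N) : ℕ) = (n : ℕ) + 1 := by
      rw [hy1, if_neg (by omega)]
    rw [flipSign, if_pos (Or.inl h0), ← cx, ex, cN, ey, cn, h0, c0, hIN, kinkSign]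
    have := hsq m
    split_ifs <;> push_cast <;> ring_nf <;> simp only [Complex.I_sq] <;> ring_nf at this ⊢ <;>
      simp [this]
  by_cases h1 : (n : ℕ) + 1 = N
  · have ex : ((n - 1 : Fin N) : ℕ) + 1 = n := by
      split_ifs at hx1 <;> omega
    have ey : ((n + 1 : Fin N) : ℕ) = 0 := by
      rw [hy1, if_pos h1]
    rw [h1, cN] at cn
    have hIn : Complex.I ^ (n : ℕ) * Complex.I = (-1) ^ (m + 1) := by
      rw [← pow_succ, h1, hIN]
    rw [flipSign, if_pos (Or.inr h1), ← cx, ex, ey, c0, zero_add, pow_one, mul_neg, hIn]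
    have hm := hsq m
    rw [kinkSign]
    split_ifs at cn ⊢
    · rw [cn] at hm ⊢
      rw [pow_add] at hm ⊢
      have := hsq (kinkCount T n)
      push_cast
      linear_combination this
    · rw [cn] at hm ⊢
      push_cast
      linear_combination hm
  · have ex : ((n - 1 : Fin N) : ℕ) + 1 = n := by
      split_ifs at hx1 <;> omega
    have ey : ((n + 1 : Fin N) : ℕ) = (n : ℕ) + 1 := by
      rw [hy1, if_neg h1]
    -- Away from the seam only a kink at n lies between the two sites, so its fermionic sign cancels
    -- `kinkSign`, and (-i)² = -1 remains.
    rw [flipSign, if_neg (by tauto), ← cx, ex, ey, cn, kinkSign]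
    have hc := hsq (kinkCount T n)
    have hI := hII n
    have e2 : (-Complex.I) ^ ((n : ℕ) + 1 + 1) = -(-Complex.I) ^ (n : ℕ) := by
      rw [add_assoc, pow_add]
      simp
    rw [e2]
    split_ifs
    · rw [pow_add]
      push_cast
      linear_combination (-(Complex.I ^ (n : ℕ) * (-Complex.I) ^ (n : ℕ))) * hc - hI
    · rw [add_zero]
      push_cast
      linear_combination (-(Complex.I ^ (n : ℕ) * (-Complex.I) ^ (n : ℕ))) * hc - hI

theorem card_symmDiff_pair {N : ℕ} (S : Finset (Fin N)) {x y : Fin N} (hxy : x ≠ y) :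
    (symmDiff S {x, y}).card + 2 * (S ∩ {x, y}).card = S.card + 2 := by
  have h1 := Finset.card_sdiff_add_card_inter S {x, y}
  have h2 := Finset.card_sdiff_add_card_inter {x, y} S
  have h3 : (symmDiff S {x, y}).card = (S \ {x, y}).card + (({x, y} : Finset (Fin N)) \ S).card :=
    Finset.card_union_of_disjoint disjoint_sdiff_sdiff
  rw [Finset.inter_comm] at h2
  rw [Finset.card_pair hxy] at h2
  omega

theorem card_symmDiff_pair_ne {N : ℕ} {S : Finset (Fin N)} {x y : Fin N} (hxy : x ≠ y)
    (h : x ∈ S ↔ y ∈ S) : (symmDiff S {x, y}).card ≠ S.card := by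
  have h1 := card_symmDiff_pair S hxy
  by_cases hx : x ∈ S
  · have h2 : S ∩ {x, y} = {x, y} := by
      rw [Finset.inter_eq_right]
      simp [Finset.insert_subset_iff, hx, h.1 hx]
    rw [h2, Finset.card_pair hxy] at h1
    omega
  · have h2 : S ∩ {x, y} = ∅ := by
      ext z
      simp only [Finset.mem_inter, Finset.mem_insert, Finset.mem_singleton, Finset.notMem_empty,
        iff_false, not_and]
      rintro hz (rfl | rfl)
      · exact hx hz
      · exact hx (h.2 hz)
    rw [h2, Finset.card_empty] at h1
    omega

theorem symmDiff_insert_pair {N : ℕ} {T : Finset (Fin N)} {x y : Fin N} (hxy : x ≠ y)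
    (hx : x ∉ T) (hy : y ∉ T) : symmDiff (insert y T) {x, y} = insert x T := by
  ext z
  simp only [Finset.mem_symmDiff, Finset.mem_insert, Finset.mem_singleton]
  by_cases h1 : z = x
  · subst h1
    simp [hx, hxy]
  · by_cases h2 : z = y
    · subst h2
      simp [hy, hxy.symm]
    · simp [h1, h2]

theorem conj_kinkSign (p : Prop) [Decidable p] : (starRingEnd ℂ) (kinkSign p) = kinkSign p := by
  rw [kinkSign]
  split_ifs <;> simp

/-- The expectation value of the hopping part of the current in a Slater determinant. -/
theorem OrthogonalColumns.sum_hop {N M : ℕ} [NeZero N] (hN : 4 ≤ N) (hM : (4 : ℤ) ∣ N - 2 * M)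
    {a : Fin N → Fin M → ℂ} (ha : OrthogonalColumns a) (n : Fin N) :
    (N : ℂ) * ∑ S, kinkSign (n ∈ S) *
        ((starRingEnd ℂ) (minor a (symmDiff S {n - 1, n + 1}) *
          kinkPrefactor (symmDiff S {n - 1, n + 1})) * (minor a S * kinkPrefactor S)) =
      -((flipSign n : ℤˣ) : ℤ) * ((N : ℂ) ^ M *
        ∑ l, ((starRingEnd ℂ) (a (n - 1) l) * a (n + 1) l +
          (starRingEnd ℂ) (a (n + 1) l) * a (n - 1) l)) := by
  have hxy := sub_one_ne_add_one hN n
  have hny := ne_add_one (by omega) n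
  have hnx : n ≠ n - 1 := fun h => ne_add_one (by omega) n (sub_eq_iff_eq_add.1 h.symm)
  -- Toggling two sites that are both occupied or both empty changes the kink number by 2, and one
  -- minor vanishes.
  have hzero (S : Finset (Fin N)) (h : n - 1 ∈ S ↔ n + 1 ∈ S) : kinkSign (n ∈ S) *
        ((starRingEnd ℂ) (minor a (symmDiff S {n - 1, n + 1}) *
          kinkPrefactor (symmDiff S {n - 1, n + 1})) * (minor a S * kinkPrefactor S)) = 0 := by
    by_cases h1 : minor a S = 0
    · simp [h1]
    · by_cases h2 : minor a (symmDiff S {n - 1, n + 1}) = 0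
      · simp [h2]
      · exact absurd ((card_eq_of_minor_ne_zero h2).trans (card_eq_of_minor_ne_zero h1).symm)
          (card_symmDiff_pair_ne hxy h)
  rw [sum_eq_sum_insert_add_insert hxy hzero]
  cases M with
  | zero =>
    have h1 (T : Finset (Fin N)) (x : Fin N) : minor a (insert x T) = 0 := dif_neg (by simp)
    simp [h1]
  | succ m =>
    have hterm (T : Finset (Fin N)) (hx : n - 1 ∉ T) (hy : n + 1 ∉ T) :
        kinkSign (n ∈ T) * ((starRingEnd ℂ) (minor a (insert (n - 1) T) *
          kinkPrefactor (insert (n - 1) T)) *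
            (minor a (insert (n + 1) T) * kinkPrefactor (insert (n + 1) T))) =
        -((flipSign n : ℤˣ) : ℤ) *
          ((starRingEnd ℂ) (insertMinor a (n - 1) T) * insertMinor a (n + 1) T) := by
      by_cases hT : T.card = m
      · have hs := hop_sign hN hM hT hx
        have hp := conj_kinkPrefactor_mul_self T
        rw [minor_insert a hx, minor_insert a hy, kinkPrefactor_insert hx, kinkPrefactor_insert hy,
          card_filter_lt, card_filter_lt, ← hs]
        simp only [map_mul, map_pow, map_neg, map_one] at hs ⊢
        linear_combination (kinkSign (n ∈ T) * ((-1) ^ kinkCount T (n - 1 : Fin N) *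
          (-1) ^ kinkCount T (n + 1 : Fin N)) * ((-(starRingEnd ℂ) Complex.I) ^
            (((n - 1 : Fin N) : ℕ) + 1) * (-Complex.I) ^ (((n + 1 : Fin N) : ℕ) + 1)) *
          ((starRingEnd ℂ) (insertMinor a (n - 1) T) * insertMinor a (n + 1) T)) * hp
      · have h1 : minor a (insert (n + 1) T) = 0 := by
          refine dif_neg ?_
          rw [Finset.card_insert_of_notMem hy]
          omega
        have h2 : insertMinor a (n + 1) T = 0 := by
          simp [insertMinor, minor, hT]
        rw [h1, h2]
        simp
    have hsum (T : Finset (Fin N)) : (if n - 1 ∉ T ∧ n + 1 ∉ T then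
        kinkSign (n ∈ insert (n - 1) T) *
          ((starRingEnd ℂ) (minor a (symmDiff (insert (n - 1) T) {n - 1, n + 1}) *
            kinkPrefactor (symmDiff (insert (n - 1) T) {n - 1, n + 1})) *
              (minor a (insert (n - 1) T) * kinkPrefactor (insert (n - 1) T))) +
        kinkSign (n ∈ insert (n + 1) T) *
          ((starRingEnd ℂ) (minor a (symmDiff (insert (n + 1) T) {n - 1, n + 1}) *
            kinkPrefactor (symmDiff (insert (n + 1) T) {n - 1, n + 1})) *
              (minor a (insert (n + 1) T) * kinkPrefactor (insert (n + 1) T))) else 0) =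
        -((flipSign n : ℤˣ) : ℤ) *
          ((starRingEnd ℂ) (insertMinor a (n - 1) T) * insertMinor a (n + 1) T) +
        -((flipSign n : ℤˣ) : ℤ) *
          ((starRingEnd ℂ) (insertMinor a (n + 1) T) * insertMinor a (n - 1) T) := by
      by_cases hx : n - 1 ∈ T
      · simp [hx, insertMinor_of_mem a hx]
      by_cases hy : n + 1 ∈ T
      · simp [hy, insertMinor_of_mem a hy]
      have k1 : kinkSign (n ∈ insert (n - 1) T) = kinkSign (n ∈ T) := by
        simp [kinkSign, hnx]
      have k2 : kinkSign (n ∈ insert (n + 1) T) = kinkSign (n ∈ T) := by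
        simp only [kinkSign, Finset.mem_insert, hny, false_or]
      -- The reverse hop is the complex conjugate, since the signs are real.
      have hc := congrArg (starRingEnd ℂ) (hterm T hx hy)
      rw [if_pos ⟨hx, hy⟩, symmDiff_insert_pair hxy hx hy, Finset.pair_comm,
        symmDiff_insert_pair hxy.symm hy hx, k1, k2, hterm T hx hy, add_comm]
      congr 1
      simp only [map_mul, map_neg, map_intCast, Complex.conj_conj, conj_kinkSign] at hc ⊢
      linear_combination hc
    simp only [hsum]
    rw [Finset.sum_add_distrib, ← Finset.mul_sum, ← Finset.mul_sum,
      ha.sum_conj_insertMinor_mul_insertMinor, ha.sum_conj_insertMinor_mul_insertMinor,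
      Finset.sum_add_distrib]
    ring

/-! ### Expectation values in the chiral states -/

theorem kinkCoeff_prefactor_sq {N : ℕ} [NeZero N] (M : ℕ) :
    2 * (1 / (Real.sqrt (2 * (N : ℝ) ^ M) : ℂ)) ^ 2 * (N : ℂ) ^ M = 1 := by
  have hN : (N : ℂ) ≠ 0 := by exact_mod_cast NeZero.ne N
  have h : (Real.sqrt (2 * (N : ℝ) ^ M) : ℂ) ^ 2 = 2 * (N : ℂ) ^ M := by
    rw [← Complex.ofReal_pow, Real.sq_sqrt (by positivity)]
    push_cast
    rfl
  rw [div_pow, h]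
  field_simp

theorem conj_kinkCoeff_mul {N M : ℕ} (ξ : Fin 2) (a : Fin N → Fin M → ℂ) (κ δ : ℤˣ)
    (S S' : Finset (Fin N)) :
    (starRingEnd ℂ) (kinkCoeff ξ a (κ * δ, S')) * kinkCoeff ξ a (κ, S) =
      (1 / (Real.sqrt (2 * (N : ℝ) ^ M) : ℂ)) ^ 2 * ((δ : ℤ) : ℂ) ^ (ξ : ℕ) *
        ((starRingEnd ℂ) (minor a S' * kinkPrefactor S') * (minor a S * kinkPrefactor S)) := by
  have h : (((κ : ℤ) : ℂ) ^ (ξ : ℕ)) * ((κ : ℤ) : ℂ) ^ (ξ : ℕ) = 1 := by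
    rw [← mul_pow]
    rcases Int.units_eq_one_or κ with rfl | rfl <;> simp
  simp only [kinkCoeff, map_mul, map_div₀, map_one, map_pow, Complex.conj_ofReal,
    map_intCast, Units.val_mul, Int.cast_mul, mul_pow]
  linear_combination ((1 / (Real.sqrt (2 * (N : ℝ) ^ M) : ℂ)) ^ 2 * ((δ : ℤ) : ℂ) ^ (ξ : ℕ) *
        ((starRingEnd ℂ) (minor a S') * (starRingEnd ℂ) (kinkPrefactor S') *
          (minor a S * kinkPrefactor S))) * h

theorem conj_kinkCoeff_mul_self {N M : ℕ} (ξ : Fin 2) (a : Fin N → Fin M → ℂ) (κ : ℤˣ)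
    (S : Finset (Fin N)) :
    (starRingEnd ℂ) (kinkCoeff ξ a (κ, S)) * kinkCoeff ξ a (κ, S) =
      (1 / (Real.sqrt (2 * (N : ℝ) ^ M) : ℂ)) ^ 2 *
        ((starRingEnd ℂ) (minor a S) * minor a S) := by
  have h := conj_kinkCoeff_mul ξ a κ 1 S S
  have hp := conj_kinkPrefactor_mul_self S
  rw [mul_one] at h
  rw [h, map_mul, Units.val_one, Int.cast_one, one_pow, mul_one]
  linear_combination ((1 / (Real.sqrt (2 * (N : ℝ) ^ M) : ℂ)) ^ 2 *
    ((starRingEnd ℂ) (minor a S) * minor a S)) * hp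

theorem star_chiralState_dotProduct_kinkVec {N M : ℕ} [NeZero N] (hN : 2 ≤ N)
    (hM : (4 : ℤ) ∣ N - 2 * M) (ξ : Fin 2) (A : ℕ → Fin M → ℂ) {κ : ℤˣ} {S : Finset (Fin N)}
    (hS : (4 : ℤ) ∣ N - 2 * S.card) :
    star (chiralState N ξ A) ⬝ᵥ kinkVec κ S =
      (starRingEnd ℂ) (kinkCoeff ξ (fun n : Fin N => A ((n : ℕ) + 1)) (κ, S)) := by
  rw [chiralState_eq]
  refine star_sum_dotProduct (V := fun i : ℤˣ × Finset (Fin N) => kinkVec i.1 i.2)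
    (P := fun i => (4 : ℤ) ∣ N - 2 * i.2.card) (j := (κ, S)) (fun i hi => ?_)
    (fun i j hi hj => star_kinkVec_dotProduct_kinkVec hN hi hj) hS
  have h : minor (fun n : Fin N => A ((n : ℕ) + 1)) i.2 ≠ 0 := by
    intro h
    exact hi (by simp [kinkCoeff, h])
  rw [card_eq_of_minor_ne_zero h]
  exact hM

theorem expect_chiralState {N M : ℕ} (ξ : Fin 2) (A : ℕ → Fin M → ℂ)
    (B : Matrix (Config N) (Config N) ℂ) :
    expect (chiralState N ξ A) B = ∑ κ : ℤˣ, ∑ S : Finset (Fin N),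
      kinkCoeff ξ (fun n : Fin N => A ((n : ℕ) + 1)) (κ, S) *
        (star (chiralState N ξ A) ⬝ᵥ (B *ᵥ kinkVec κ S)) := by
  rw [← Fintype.sum_prod_type' (f := fun κ S =>
    kinkCoeff ξ (fun n : Fin N => A ((n : ℕ) + 1)) (κ, S) *
        (star (chiralState N ξ A) ⬝ᵥ (B *ᵥ kinkVec κ S)))]
  conv_lhs => rw [chiralState_eq, expect_sum]
  rw [← chiralState_eq]

theorem IsUnimodularAmplitude.conj_mul_self {N M : ℕ} {ξ : Fin 2} {z : Fin M → ℂ}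
    {s A : ℕ → Fin M → ℂ} (h : IsUnimodularAmplitude N ξ z s A) (n : ℕ) (l : Fin M) :
    (starRingEnd ℂ) (A n l) * A n l = 1 := by
  rw [mul_comm, Complex.mul_conj, Complex.normSq_eq_norm_sq, h.eq_mul, norm_mul, norm_pow,
    h.norm_z, h.norm_s]
  simp

theorem IsUnimodularAmplitude.s_two_mul_add {N M : ℕ} {ξ : Fin 2} {z : Fin M → ℂ}
    {s A : ℕ → Fin M → ℂ} (h : IsUnimodularAmplitude N ξ z s A) (j n : ℕ) (l : Fin M) :
    s (2 * j + n) l = s n l := by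
  induction j with
  | zero => simp
  | succ j ih => rw [← ih, mul_add, mul_one, add_right_comm, h.periodic]

theorem conj_mul_self_of_norm_eq_one {w : ℂ} (hw : ‖w‖ = 1) : (starRingEnd ℂ) w * w = 1 := by
  rw [mul_comm, Complex.mul_conj, Complex.normSq_eq_norm_sq, hw]
  simp

theorem sum_range_two_mul (f : ℕ → ℂ) (k : ℕ) :
    ∑ n ∈ Finset.range (2 * k), f n = ∑ j ∈ Finset.range k, (f (2 * j) + f (2 * j + 1)) := by
  induction k with
  | zero => simp
  | succ k ih =>
    rw [mul_add, mul_one, Finset.sum_range_succ, Finset.sum_range_succ, ih,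
      Finset.sum_range_succ, add_assoc]

/-- With w = z̄_l z_{l'}, grouping the sites in pairs leaves a geometric series in w², which sums to
zero because w^N = 1. If w² = 1, distinctness leaves w = -1; then the s-factors agree and the terms
of a pair cancel. -/
theorem IsUnimodularAmplitude.orthogonalColumns {N M : ℕ} (hN : Even N) {ξ : Fin 2}
    {z : Fin M → ℂ} {s A : ℕ → Fin M → ℂ} (h : IsUnimodularAmplitude N ξ z s A) :
    OrthogonalColumns fun n : Fin N => A ((n : ℕ) + 1) := by
  intro l l'
  by_cases hl : l = l'
  · subst hl
    simp [h.conj_mul_self]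
  rw [if_neg hl, Fin.sum_univ_eq_sum_range (fun n => (starRingEnd ℂ) (A (n + 1) l) * A (n + 1) l')]
  obtain ⟨k, hk⟩ := hN
  rw [← two_mul] at hk
  set w := (starRingEnd ℂ) (z l) * z l' with hw
  have hzc := conj_mul_self_of_norm_eq_one (h.norm_z l)
  have hterm (n : ℕ) : (starRingEnd ℂ) (A (n + 1) l) * A (n + 1) l' =
      w ^ (n + 1) * ((starRingEnd ℂ) (s (n + 1) l) * s (n + 1) l') := by
    rw [h.eq_mul, h.eq_mul, hw, map_mul, map_pow, mul_pow]
    ring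
  have hzl' : z l' = w * z l := by
    rw [hw]
    linear_combination -(z l') * hzc
  have hpair (j : ℕ) : w ^ (2 * j + 1) * ((starRingEnd ℂ) (s (2 * j + 1) l) * s (2 * j + 1) l') +
      w ^ (2 * j + 1 + 1) *
        ((starRingEnd ℂ) (s (2 * j + 1 + 1) l) * s (2 * j + 1 + 1) l') =
      (w ^ 2) ^ j * (w * ((starRingEnd ℂ) (s 1 l) * s 1 l') +
        w ^ 2 * ((starRingEnd ℂ) (s 2 l) * s 2 l')) := by
    rw [add_assoc (2 * j) 1 1, h.s_two_mul_add j 1, h.s_two_mul_add j 1, h.s_two_mul_add j (1 + 1), h.s_two_mul_add j (1 + 1)]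
    ring
  rw [hk, sum_range_two_mul]
  simp only [hterm, hpair]
  rw [← Finset.sum_mul]
  by_cases hw2 : w ^ 2 = 1
  · rcases mul_self_eq_one_iff.1 ((sq w).symm.trans hw2) with h1 | h1
    · rw [h1, one_mul] at hzl'
      exact absurd (h.injective hzl').symm hl
    · rw [h1, neg_one_mul] at hzl'
      have hs (n : ℕ) : (starRingEnd ℂ) (s n l) * s n l' = 1 := by
        rw [h.eq_of_neg n l l' hzl', conj_mul_self_of_norm_eq_one (h.norm_s n l)]
      rw [hs, hs, h1]
      ring
  · have hwN : (w ^ 2) ^ k = 1 := by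
      rw [← pow_mul, ← hk, hw, mul_pow, ← map_pow, h.pow_eq, h.pow_eq, map_pow, map_neg, map_one,
        ← mul_pow]
      simp
    rw [geom_sum_eq hw2, hwN, sub_self, zero_div, zero_mul]

/-- In the bulk, period 2 of s cancels the s-factors and two powers of z̄ remain. Across the seam,
z^N = (-1)^{ξ+1} cancels the power of `flipSign`, and even N keeps the s-factors matched. -/
theorem flipSign_pow_mul {N M : ℕ} [NeZero N] (hN : 4 ≤ N) (hNe : Even N) {ξ : Fin 2}
    {z : Fin M → ℂ} {s A : ℕ → Fin M → ℂ} (h : IsUnimodularAmplitude N ξ z s A) (n : Fin N)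
    (l : Fin M) :
    ((flipSign n : ℤˣ) : ℂ) ^ ((ξ : ℕ) + 1) *
      ((starRingEnd ℂ) (A (((n + 1 : Fin N) : ℕ) + 1) l) * A (((n - 1 : Fin N) : ℕ) + 1) l) =
      (starRingEnd ℂ) (z l) ^ 2 := by
  have hx1 := val_add_one_eq (by omega) (n - 1)
  have hy1 := val_add_one_eq (by omega) n
  rw [sub_add_cancel] at hx1
  have hylt := (n + 1).isLt
  have hxlt := (n - 1).isLt
  have hzc := conj_mul_self_of_norm_eq_one (h.norm_z l)
  have hsc (n : ℕ) := conj_mul_self_of_norm_eq_one (h.norm_s n l)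
  have hzk (k : ℕ) : (starRingEnd ℂ) (z l) ^ k * z l ^ k = 1 := by
    rw [← mul_pow, hzc, one_pow]
  have hsq : ((-1 : ℂ) ^ ((ξ : ℕ) + 1)) * (-1) ^ ((ξ : ℕ) + 1) = 1 := by
    rw [← mul_pow]
    simp
  have hpow := h.pow_eq l
  obtain ⟨k, hk⟩ := hNe
  rw [h.eq_mul, h.eq_mul, map_mul, map_pow, flipSign]
  by_cases h0 : (n : ℕ) = 0
  · have ex : ((n - 1 : Fin N) : ℕ) + 1 = N := by
      split_ifs at hx1 <;> omega
    have ey : ((n + 1 : Fin N) : ℕ) = 1 := by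
      rw [hy1, if_neg (by omega), h0]
    have hs : s N l = s 2 l := by
      have := h.s_two_mul_add (k - 1) 2 l
      rw [← this]
      congr 1
      omega
    rw [if_pos (Or.inl h0), ex, ey, hs, hpow]
    push_cast
    have := hsc 2
    linear_combination ((starRingEnd ℂ) (z l) ^ 2 * ((starRingEnd ℂ) (s 2 l) * s 2 l)) * hsq +
      (starRingEnd ℂ) (z l) ^ 2 * this
  by_cases h1 : (n : ℕ) + 1 = N
  · have ex : ((n - 1 : Fin N) : ℕ) + 1 = N - 1 := by
      split_ifs at hx1 <;> omega
    have ey : ((n + 1 : Fin N) : ℕ) = 0 := by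
      rw [hy1, if_pos h1]
    have hs : s (N - 1) l = s 1 l := by
      have := h.s_two_mul_add (k - 1) 1 l
      rw [← this]
      congr 1
      omega
    have hzN : z l ^ (N - 1) * z l = (-1) ^ ((ξ : ℕ) + 1) := by
      rw [← pow_succ, Nat.sub_add_cancel (by omega), hpow]
    have hzN' : z l ^ (N - 1) = (starRingEnd ℂ) (z l) * (-1) ^ ((ξ : ℕ) + 1) := by
      linear_combination (starRingEnd ℂ) (z l) * hzN - z l ^ (N - 1) * hzc
    rw [if_pos (Or.inr h1), ex, ey, hs, hzN']
    push_cast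
    have := hsc 1
    linear_combination ((starRingEnd ℂ) (z l) ^ 2 * ((starRingEnd ℂ) (s 1 l) * s 1 l)) * hsq +
      (starRingEnd ℂ) (z l) ^ 2 * this
  · have ex : ((n - 1 : Fin N) : ℕ) + 1 = n := by
      split_ifs at hx1 <;> omega
    have ey : ((n + 1 : Fin N) : ℕ) = (n : ℕ) + 1 := by
      rw [hy1, if_neg h1]
    rw [if_neg (by tauto), ex, ey, add_assoc, h.periodic, pow_add]
    push_cast
    rw [one_pow]
    linear_combination ((starRingEnd ℂ) (z l) ^ 2 * ((starRingEnd ℂ) (s n l) * s n l)) * hzk n +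
      (starRingEnd ℂ) (z l) ^ 2 * hsc n

theorem IsUnimodularAmplitude.expect_currentOp {N M : ℕ} [NeZero N] (hN : 4 ≤ N)
    (hM : Admissible N M) {ξ : Fin 2} {z : Fin M → ℂ} {s A : ℕ → Fin M → ℂ}
    (h : IsUnimodularAmplitude N ξ z s A) (n : Fin N) :
    expect (chiralState N ξ A) (currentOp n) =
      1 + 1 / (N : ℂ) * ∑ l, ((starRingEnd ℂ) (z l) ^ 2 + z l ^ 2 - 2) := by
  have hN0 : (N : ℂ) ≠ 0 := by exact_mod_cast NeZero.ne N
  have hdvd := hM.dvd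
  have ha := h.orthogonalColumns hM.1
  set a : Fin N → Fin M → ℂ := fun n : Fin N => A ((n : ℕ) + 1) with ha_def
  set ν : ℂ := (1 / (Real.sqrt (2 * (N : ℝ) ^ M) : ℂ)) with hν
  have hterm (κ : ℤˣ) (S : Finset (Fin N)) :
      kinkCoeff ξ a (κ, S) * (star (chiralState N ξ A) ⬝ᵥ (currentOp n *ᵥ kinkVec κ S)) =
      ν ^ 2 * (kinkSign (n ∈ S) * ((starRingEnd ℂ) (minor a S) * minor a S)) -
      ν ^ 2 * ((flipSign n : ℤˣ) : ℂ) ^ (ξ : ℕ) * (kinkSign (n ∈ S) *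
        ((starRingEnd ℂ) (minor a (symmDiff S {n - 1, n + 1}) *
          kinkPrefactor (symmDiff S {n - 1, n + 1})) * (minor a S * kinkPrefactor S))) := by
    by_cases h0 : minor a S = 0
    · simp [kinkCoeff, h0]
    have hS : (4 : ℤ) ∣ N - 2 * S.card := by
      rw [card_eq_of_minor_ne_zero h0]
      exact hdvd
    -- Toggling two sites preserves the parity of the kink number, so the image still belongs to the
    -- orthonormal family even when that number changes.
    have hS' : (4 : ℤ) ∣ N - 2 * (symmDiff S {n - 1, n + 1}).card := by
      have := card_symmDiff_pair S (sub_one_ne_add_one hN n)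
      omega
    have e1 := conj_kinkCoeff_mul ξ a κ (flipSign n) S (symmDiff S {n - 1, n + 1})
    have e2 := conj_kinkCoeff_mul_self ξ a κ S
    rw [currentOp_mulVec_kinkVec hN κ hS, dotProduct_smul, dotProduct_sub,
      star_chiralState_dotProduct_kinkVec (by omega) hdvd ξ A hS,
      star_chiralState_dotProduct_kinkVec (by omega) hdvd ξ A hS', smul_eq_mul]
    linear_combination kinkSign (n ∈ S) * e2 - kinkSign (n ∈ S) * e1
  have hcard : ∀ c : ℂ, ∑ _κ : ℤˣ, c = 2 * c := fun c => by simp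
  have hsum : expect (chiralState N ξ A) (currentOp n) = _ :=
    (expect_chiralState ξ A (currentOp n)).trans
      (Finset.sum_congr rfl fun κ _ => Finset.sum_congr rfl fun S _ => hterm κ S)
  rw [hcard, Finset.sum_sub_distrib, ← Finset.mul_sum, ← Finset.mul_sum] at hsum
  have hd := ha.sum_kinkSign_mul n
  have hh := ha.sum_hop hN hdvd n
  have hν2 := kinkCoeff_prefactor_sq (N := N) M
  rw [← hν] at hν2
  have hone : ∑ l, (starRingEnd ℂ) (a n l) * a n l = M := by
    simp [ha_def, h.conj_mul_self]
  rw [hone] at hd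
  have hflip : ((flipSign n : ℤˣ) : ℂ) ^ ((ξ : ℕ) + 1) *
      ∑ l, ((starRingEnd ℂ) (a (n - 1) l) * a (n + 1) l +
          (starRingEnd ℂ) (a (n + 1) l) * a (n - 1) l) =
      ∑ l, ((starRingEnd ℂ) (z l) ^ 2 + z l ^ 2) := by
    rw [Finset.mul_sum]
    refine Finset.sum_congr rfl fun l _ => ?_
    have e1 := flipSign_pow_mul hN hM.1 h n l
    have e2 := congrArg (starRingEnd ℂ) e1
    simp only [map_mul, map_pow, Complex.conj_conj, map_intCast] at e2
    linear_combination e1 + e2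
  have hM2 : ∑ l, ((starRingEnd ℂ) (z l) ^ 2 + z l ^ 2 - 2) =
      ∑ l, ((starRingEnd ℂ) (z l) ^ 2 + z l ^ 2) - 2 * M := by
    rw [Finset.sum_sub_distrib]
    simp [mul_comm]
  rw [hM2, ← hflip]
  refine mul_left_cancel₀ hN0 ?_
  rw [hsum]
  -- The factor 2 counts κ = ±1, and 2ν²N^M = 1 is the normalization. The hop contributes `flipSign`
  -- once more than κ^ξ does, which is the exponent ξ+1 in `hflip`.
  linear_combination (2 * ν ^ 2) * hd - (2 * ν ^ 2 * ((flipSign n : ℤˣ) : ℂ) ^ (ξ : ℕ)) * hh -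
    (((flipSign n : ℤˣ) : ℂ) ^ ((ξ : ℕ) + 1) *
      ∑ l, ((starRingEnd ℂ) (a (n - 1) l) * a (n + 1) l +
          (starRingEnd ℂ) (a (n + 1) l) * a (n - 1) l) - 2 * M) * mul_one_div_cancel hN0 +
    (N - 2 * M + ((flipSign n : ℤˣ) : ℂ) ^ ((ξ : ℕ) + 1) *
      ∑ l, ((starRingEnd ℂ) (a (n - 1) l) * a (n + 1) l +
          (starRingEnd ℂ) (a (n + 1) l) * a (n - 1) l)) * hν2

theorem IsUnimodularAmplitude.expect_sigmaX_mul_sigmaY {N M : ℕ} [NeZero N] (hN : 4 ≤ N)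
    (hM : Admissible N M) {ξ : Fin 2} {z : Fin M → ℂ} {s A : ℕ → Fin M → ℂ}
    (h : IsUnimodularAmplitude N ξ z s A) :
    expect (chiralState N ξ A) (sigmaX (0 : Fin N) * sigmaY (1 : Fin N)) =
      ((1 - 2 * (M : ℝ) / (N : ℝ) : ℝ) : ℂ) := by
  have hN0 : (N : ℂ) ≠ 0 := by exact_mod_cast NeZero.ne N
  have hN2 : 2 ≤ N := by omega
  have hdvd := hM.dvd
  have ha := h.orthogonalColumns hM.1
  set a : Fin N → Fin M → ℂ := fun n : Fin N => A ((n : ℕ) + 1) with ha_def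
  set ν : ℂ := (1 / (Real.sqrt (2 * (N : ℝ) ^ M) : ℂ)) with hν
  have hterm (κ : ℤˣ) (S : Finset (Fin N)) :
      kinkCoeff ξ a (κ, S) * (star (chiralState N ξ A) ⬝ᵥ
        ((sigmaX (0 : Fin N) * sigmaY (1 : Fin N)) *ᵥ kinkVec κ S)) =
      ν ^ 2 * (kinkSign (0 ∈ S) * ((starRingEnd ℂ) (minor a S) * minor a S)) := by
    by_cases h0 : minor a S = 0
    · simp [kinkCoeff, h0]
    have hS : (4 : ℤ) ∣ N - 2 * S.card := by
      rw [card_eq_of_minor_ne_zero h0]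
      exact hdvd
    have e2 := conj_kinkCoeff_mul_self ξ a κ S
    have hne : (0 : Fin N) ≠ 1 := by
      have := ne_add_one hN2 (0 : Fin N)
      rwa [zero_add] at this
    have hp := kinkPhase_add_one hN2 κ hS 0
    rw [zero_add] at hp
    have hev : Even (kinkPhase κ S 0) := by
      rw [kinkPhase_zero]
      rcases Int.units_eq_one_or κ with rfl | rfl <;> decide
    rw [kinkVec, sigmaX_mul_sigmaY_mulVec_of_even hne _ hp hev, dotProduct_smul, ← kinkVec,
      star_chiralState_dotProduct_kinkVec hN2 hdvd ξ A hS, smul_eq_mul]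
    linear_combination kinkSign (0 ∈ S) * e2
  have hcard : ∀ c : ℂ, ∑ _κ : ℤˣ, c = 2 * c := fun c => by simp
  have hsum : expect (chiralState N ξ A) (sigmaX (0 : Fin N) * sigmaY (1 : Fin N)) = _ :=
    (expect_chiralState ξ A _).trans
      (Finset.sum_congr rfl fun κ _ => Finset.sum_congr rfl fun S _ => hterm κ S)
  rw [hcard, ← Finset.mul_sum] at hsum
  have hd := ha.sum_kinkSign_mul 0
  have hν2 := kinkCoeff_prefactor_sq (N := N) M
  rw [← hν] at hν2
  have hone : ∑ l, (starRingEnd ℂ) (a 0 l) * a 0 l = M := by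
    simp only [ha_def, h.conj_mul_self]
    simp
  rw [hone] at hd
  refine mul_left_cancel₀ hN0 ?_
  rw [hsum]
  push_cast
  linear_combination (2 * ν ^ 2) * hd + (N - 2 * M : ℂ) * hν2 +
    (2 * M : ℂ) * mul_one_div_cancel hN0

theorem conj_exp_sq_add_exp_sq (p : ℝ) :
    (starRingEnd ℂ) (Complex.exp (Complex.I * p)) ^ 2 + Complex.exp (Complex.I * p) ^ 2 - 2 =
      -4 * Complex.sin p ^ 2 := by
  rw [mul_comm, Complex.exp_mul_I, map_add, map_mul, Complex.conj_I, ← Complex.cos_conj,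
    ← Complex.sin_conj, Complex.conj_ofReal]
  have h := Complex.sin_sq_add_cos_sq (p : ℂ)
  linear_combination 2 * h + 2 * Complex.sin p ^ 2 * Complex.I_sq

theorem expect_eq_sin_sq {N M : ℕ} (p : Fin M → ℝ) :
    1 + 1 / (N : ℂ) * ∑ l, ((starRingEnd ℂ) (Complex.exp (Complex.I * p l)) ^ 2 +
      Complex.exp (Complex.I * p l) ^ 2 - 2) =
      ((1 - 4 / (N : ℝ) * ∑ j, Real.sin (p j) ^ 2 : ℝ) : ℂ) := by
  simp only [conj_exp_sq_add_exp_sq, ← Finset.mul_sum]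
  push_cast
  ring

theorem calY_eq {τ u : ℂ} (h : ‖momentumRatio τ u‖ = 1) :
    calY τ u = (starRingEnd ℂ) (momentumRatio τ u) ^ 2 + momentumRatio τ u ^ 2 - 2 := by
  rw [← Complex.inv_eq_conj h, momentumRatio, inv_div]
  rfl

end ChiralXY

end

theorem mainTheorem5 (N : ℕ) [NeZero N] (hN : 4 ≤ N) (M : ℕ)
    (hM : ChiralXY.Admissible N M) (ξ : Fin 2) :
    -- XY chain
    (∀ τ : ℂ, τ.re = 0 → 0 < τ.im →
      -- eigenstates parametrized by Bethe roots `u`, with quasi-momenta `p j = p(u j)`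
      (∀ (u : Fin M → ℂ) (p : Fin M → ℝ), ChiralXY.IsBetheRoots N τ ξ u →
        (∀ j, Complex.exp (Complex.I * p j) = ChiralXY.momentumRatio τ (u j)) →
        (∀ n : Fin N,
          ChiralXY.expect (ChiralXY.xyState N τ ξ u) (ChiralXY.currentOp n) =
              1 + 1 / (N : ℂ) * ∑ j, ChiralXY.calY τ (u j) ∧
          ChiralXY.expect (ChiralXY.xyState N τ ξ u) (ChiralXY.currentOp n) =
              ((1 - 4 / (N : ℝ) * ∑ j, Real.sin (p j) ^ 2 : ℝ) : ℂ)) ∧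
        ChiralXY.expect (ChiralXY.xyState N τ ξ u)
            (ChiralXY.sigmaX (0 : Fin N) * ChiralXY.sigmaY (1 : Fin N)) =
          ((1 - 2 * (M : ℝ) / (N : ℝ) : ℝ) : ℂ)) ∧
      -- eigenstates parametrized by quasi-momenta
      (∀ (Jx Jy : ℝ) (p : Fin M → ℝ),
        (Jx : ℂ) = ChiralXY.theta3 τ 0 / ChiralXY.theta4 τ 0 →
        (Jy : ℂ) = ChiralXY.theta4 τ 0 / ChiralXY.theta3 τ 0 →
        ChiralXY.IsQuasiMomenta N (-(Real.pi / 2)) ξ p →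
        (∀ n : Fin N,
          ChiralXY.expect (ChiralXY.xyMomentumState N Jx Jy ξ p) (ChiralXY.currentOp n) =
            ((1 - 4 / (N : ℝ) * ∑ j, Real.sin (p j) ^ 2 : ℝ) : ℂ)) ∧
        ChiralXY.expect (ChiralXY.xyMomentumState N Jx Jy ξ p)
            (ChiralXY.sigmaX (0 : Fin N) * ChiralXY.sigmaY (1 : Fin N)) =
          ((1 - 2 * (M : ℝ) / (N : ℝ) : ℝ) : ℂ))) ∧
    -- XX chain
    (∀ p : Fin M → ℝ, ChiralXY.IsQuasiMomenta N (-Real.pi) ξ p →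
      ∀ n : Fin N,
        ChiralXY.expect (ChiralXY.xxState N ξ p) (ChiralXY.currentOp n) =
          ((1 - 4 / (N : ℝ) * ∑ j, Real.sin (p j) ^ 2 : ℝ) : ℂ)) := by
  have hsin : ∀ {A : ℕ → Fin M → ℂ} {s : ℕ → Fin M → ℂ} {p : Fin M → ℝ},
      ChiralXY.IsUnimodularAmplitude N ξ (fun l => Complex.exp (Complex.I * p l)) s A →
      ∀ n : Fin N, ChiralXY.expect (ChiralXY.chiralState N ξ A) (ChiralXY.currentOp n) =
        ((1 - 4 / (N : ℝ) * ∑ j, Real.sin (p j) ^ 2 : ℝ) : ℂ) := fun h n =>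
    (h.expect_currentOp hN hM n).trans (ChiralXY.expect_eq_sin_sq _)
  refine ⟨fun τ hre him => ?_, fun p hp n => hsin hp.isUnimodularAmplitude_xx n⟩
  obtain ⟨t, rfl⟩ : ∃ t : ℝ, τ = t * Complex.I :=
    ⟨τ.im, Complex.ext (by simp [hre]) (by simp)⟩
  have ht : 0 < t := by simpa using him
  refine ⟨fun u p hu hp => ?_, fun Jx Jy p _ _ hp => ?_⟩
  · have hA := hu.isUnimodularAmplitude ht
    have hA' := hA
    simp only [← hp] at hA'
    refine ⟨fun n => ⟨(hA.expect_currentOp hN hM n).trans ?_, hsin hA' n⟩,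
      hA.expect_sigmaX_mul_sigmaY hN hM⟩
    simp only [fun l => ChiralXY.calY_eq (hA.norm_z l)]
  · have hA := hp.isUnimodularAmplitude_xy Jx Jy
    exact ⟨hsin hA, hA.expect_sigmaX_mul_sigmaY hN hM⟩
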